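/- Let $G=G_{\bar 0}\oplus G_{\bar 1}=sl(2/1)$ be the complex Lie superalgebra of $3\times 3$ matrices $A$ with $A_{11}+A_{22}-A_{33}=0$. Here $G_{\bar 0}\cong gl(2)$ consists of the block diagonal matrices. Let $G_{+1}=\langle E_{13},E_{23}\rangle$ and let $H=\langle E_{11}-E_{22},\,E_{22}+E_{33}\rangle$ be the diagonal Cartan subalgebra. A $G$-module is a module over the enveloping algebra $U(G)$. It is a weight module if it is the direct sum of its weight spaces with respect to $H$ and all of them are finite dimensional. A module is indecomposable if it is nonzero and is not the direct sum of two nonzero submodules. For an indecomposable $G_{\bar 0}$-module $W$, let $$\overline W=U(G)\otimes_{U(G_{\bar 0}\oplus G_{+1})}W$$ be the induced module, where $G_{+1}$ acts on $W$ by zero, and identify $W$ with $1\otimes W\subset\overline W$. The module $\overline W$ is called typical if $N=0$ is the only $G$-submodule $N$ of $\overline W$ with $N\cap W=0$. **Proposition 3.3.** Let $V$ be an indecomposable weight $G$-module which contains a typical induced module $\overline W$, that is, there is an injective $G$-module homomorphism $\overline W\to V$, through which $W$ and $\overline W$ are viewed as subspaces of $V$. Then $V$ is an induced module. More precisely, there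 is a maximal indecomposable $G_{\bar 0}$-submodule $W'$ of $V$ containing $W$, and for every such $W'$ the inclusion $W'\subset V$ extends to an isomorphism of $G$-modules $\overline{W'}\cong V$. -/

import Mathlib

open scoped TensorProduct

noncomputable section

namespace SL21

/-- Complex `3 × 3` matrices; the index `2` is the odd one, `0` and `1` are even. -/
abbrev M3 : Type := Matrix (Fin 3) (Fin 3) ℂ

/-- Parity of a matrix index. -/
def idxParity : Fin 3 → ZMod 2 := ![0, 0, 1]

/-- The supertrace `A ↦ A₁₁ + A₂₂ - A₃₃`. -/
def supertrace : M3 →ₗ[ℂ] ℂ where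
  toFun A := A 0 0 + A 1 1 - A 2 2
  map_add' A B := by simp only [Matrix.add_apply]; ring
  map_smul' a A := by simp only [Matrix.smul_apply, smul_eq_mul, RingHom.id_apply]; ring

/-- The homogeneous component of parity `p` of a matrix. -/
def component (p : ZMod 2) (A : M3) : M3 :=
  Matrix.of fun i j => if idxParity i + idxParity j = p then A i j else 0

/-- `A` is homogeneous of parity `p`. -/
def IsHomogeneous (p : ZMod 2) (A : M3) : Prop := component p A = A

/-- The sign `(-1)^{pq}`. -/
def koszulSign (p q : ZMod 2) : ℂ := (-1) ^ (p.val * q.val)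

/-- The superbracket: the bilinear extension of `[A, B] = AB - (-1)^{pq} BA` for `A`, `B`
homogeneous of parities `p`, `q`. -/
def superBracketMatrix (A B : M3) : M3 :=
  ∑ p : ZMod 2, ∑ q : ZMod 2,
    (component p A * component q B - koszulSign p q • (component q B * component p A))

theorem superBracketMatrix_of_homogeneous {p q : ZMod 2} {A B : M3}
    (hA : IsHomogeneous p A) (hB : IsHomogeneous q B) :
    superBracketMatrix A B = A * B - koszulSign p q • (B * A) := by
  have key : ∀ {r s : ZMod 2} {C : M3}, IsHomogeneous r C → s ≠ r → component s C = 0 := by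
    intro r s C hC hs
    ext i j
    rw [← hC]
    simp only [component, Matrix.of_apply, Matrix.zero_apply]
    split_ifs with h1 h2
    · exact absurd (h1.symm.trans h2) hs
    · rfl
    · rfl
  unfold superBracketMatrix
  rw [Finset.sum_eq_single p, Finset.sum_eq_single q]
  · rw [hA, hB]
  · intro s _ hs
    simp [key hB hs]
  · simp
  · intro s _ hs
    simp [key hA hs]
  · simp

/-- The underlying space of the Lie superalgebra `G = sl(2/1)`: matrices of supertrace `0`. -/
def G : Submodule ℂ M3 := LinearMap.ker supertrace

theorem superBracketMatrix_mem (A B : M3) : superBracketMatrix A B ∈ G := by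
  have h2 : (Finset.univ : Finset (ZMod 2)) = {0, 1} := rfl
  have e0 : idxParity 0 = 0 := rfl
  have e1 : idxParity 1 = 0 := rfl
  have e2 : idxParity 2 = 1 := rfl
  have v0 : (0 : ZMod 2).val = 0 := rfl
  have v1 : (1 : ZMod 2).val = 1 := rfl
  have n : (1 : ZMod 2) + 1 = 0 := rfl
  have n01 : (0 : ZMod 2) ≠ 1 := by decide
  have n10 : (1 : ZMod 2) ≠ 0 := by decide
  simp only [G, LinearMap.mem_ker, supertrace, LinearMap.coe_mk, AddHom.coe_mk,
    superBracketMatrix, h2, Finset.sum_insert (Finset.notMem_singleton.2 n01),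
    Finset.sum_singleton, Matrix.add_apply, Matrix.sub_apply, Matrix.smul_apply,
    Matrix.mul_apply, Fin.sum_univ_three, component, Matrix.of_apply, koszulSign,
    e0, e1, e2, v0, v1, n, add_zero, zero_add, n01, n10, if_true, if_false, smul_eq_mul]
  ring

/-- The superbracket of `sl(2/1)`. -/
def superBracket (x y : G) : G :=
  ⟨superBracketMatrix x.1 y.1, superBracketMatrix_mem x.1 y.1⟩

/-- The defining relations `xy = (-1)^{pq} yx + [x, y]` of `U(G)`, for `x`, `y` homogeneous of
parities `p`, `q`. -/
inductive URel : TensorAlgebra ℂ G → TensorAlgebra ℂ G → Prop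
  | bracket (p q : ZMod 2) (x y : G) (hx : IsHomogeneous p x.1) (hy : IsHomogeneous q y.1) :
      URel (TensorAlgebra.ι ℂ x * TensorAlgebra.ι ℂ y)
        (koszulSign p q • (TensorAlgebra.ι ℂ y * TensorAlgebra.ι ℂ x) +
          TensorAlgebra.ι ℂ (superBracket x y))

/-- The universal enveloping algebra `U(G)`. A `G`-module is a module over it. -/
def U : Type := RingQuot URel

instance : Ring U := inferInstanceAs (Ring (RingQuot URel))

instance : Algebra ℂ U := inferInstanceAs (Algebra ℂ (RingQuot URel))

/-- The canonical map `G → U(G)`. -/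
def ι : G →ₗ[ℂ] U := (RingQuot.mkAlgHom ℂ URel).toLinearMap ∘ₗ TensorAlgebra.ι ℂ

theorem ι_mul_ι {p q : ZMod 2} {x y : G} (hx : IsHomogeneous p x.1) (hy : IsHomogeneous q y.1) :
    ι x * ι y = koszulSign p q • (ι y * ι x) + ι (superBracket x y) := by
  have h := RingQuot.mkAlgHom_rel ℂ (URel.bracket p q x y hx hy)
  simp only [map_mul, map_add, map_smul] at h
  exact h

theorem isHomogeneous_zero_iff {A : M3} :
    IsHomogeneous 0 A ↔ A 0 2 = 0 ∧ A 1 2 = 0 ∧ A 2 0 = 0 ∧ A 2 1 = 0 := by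
  have e0 : idxParity 0 = 0 := rfl
  have e1 : idxParity 1 = 0 := rfl
  have e2 : idxParity 2 = 1 := rfl
  have n : (1 : ZMod 2) + 1 = 0 := rfl
  have n10 : (1 : ZMod 2) ≠ 0 := by decide
  simp only [IsHomogeneous, ← Matrix.ext_iff, Fin.forall_fin_succ, component, Matrix.of_apply,
    Fin.succ_zero_eq_one, Fin.succ_one_eq_two, IsEmpty.forall_iff, and_true, e0, e1, e2, n,
    add_zero, zero_add, n10, if_true, if_false, true_and, eq_comm (a := (0 : ℂ))]

/-- Matrices form a Lie algebra under the commutator. -/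
instance : LieRing M3 := LieRing.ofAssociativeRing

instance : LieAlgebra ℂ M3 := LieAlgebra.ofAssociativeAlgebra

/-- The even part `G₀ ≅ gl(2)` of `sl(2/1)`, a Lie algebra under the commutator. -/
def G0 : LieSubalgebra ℂ M3 where
  carrier := {A | A ∈ G ∧ IsHomogeneous 0 A}
  add_mem' := by
    rintro A B ⟨hA, hA'⟩ ⟨hB, hB'⟩
    refine ⟨G.add_mem hA hB, ?_⟩
    rw [isHomogeneous_zero_iff] at *
    simp [hA', hB']
  zero_mem' := ⟨G.zero_mem, by rw [isHomogeneous_zero_iff]; simp⟩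
  smul_mem' := by
    rintro a A ⟨hA, hA'⟩
    refine ⟨G.smul_mem a hA, ?_⟩
    rw [isHomogeneous_zero_iff] at *
    simp [hA']
  lie_mem' := by
    rintro A B ⟨hA, hA'⟩ ⟨hB, hB'⟩
    have h := superBracketMatrix_mem A B
    rw [superBracketMatrix_of_homogeneous hA' hB'] at h
    refine ⟨by simpa [koszulSign, Ring.lie_def] using h, ?_⟩
    rw [isHomogeneous_zero_iff] at *
    simp [Ring.lie_def, Matrix.mul_apply, Fin.sum_univ_three, hA', hB']

/-- The inclusion `G₀ ⊆ G`. -/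
def G0.toG : G0 →ₗ[ℂ] G where
  toFun x := ⟨x.1, x.2.1⟩
  map_add' _ _ := rfl
  map_smul' _ _ := rfl

theorem ι_lie (x y : G0) :
    ι (G0.toG ⁅x, y⁆) = ι (G0.toG x) * ι (G0.toG y) - ι (G0.toG y) * ι (G0.toG x) := by
  have hx : IsHomogeneous 0 (G0.toG x).1 := x.2.2
  have hy : IsHomogeneous 0 (G0.toG y).1 := y.2.2
  have hb : superBracket (G0.toG x) (G0.toG y) = G0.toG ⁅x, y⁆ := by
    apply Subtype.ext
    change superBracketMatrix _ _ = x.1 * y.1 - y.1 * x.1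
    rw [superBracketMatrix_of_homogeneous hx hy]
    simp [koszulSign, G0.toG]
  have h := ι_mul_ι hx hy
  rw [hb] at h
  rw [h]
  simp [koszulSign]

/-- The odd subspace `G₊₁ = ⟨e₂, e₃⟩ = ⟨E₂₃, E₁₃⟩`. -/
def Gplus : Submodule ℂ G where
  carrier := {x | ∀ i j : Fin 3, ¬ (i ≠ 2 ∧ j = 2) → x.1 i j = 0}
  add_mem' := by
    intro x y hx hy i j hij
    simp [hx i j hij, hy i j hij]
  zero_mem' := by
    intro i j _
    rfl
  smul_mem' := by
    intro a x hx i j hij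
    simp [hx i j hij]

/-- The Cartan subalgebra `H = ⟨h₁, h₂⟩` of diagonal matrices of supertrace `0`. -/
def H : Submodule ℂ G where
  carrier := {x | ∀ i j : Fin 3, i ≠ j → x.1 i j = 0}
  add_mem' := by
    intro x y hx hy i j hij
    simp [hx i j hij, hy i j hij]
  zero_mem' := by
    intro i j _
    rfl
  smul_mem' := by
    intro a x hx i j hij
    simp [hx i j hij]

section Modules

variable (V : Type*) [AddCommGroup V] [Module ℂ V] [Module U V] [IsScalarTower ℂ U V]

/-- A `G`-module is a `G₀`-module by restriction. -/
instance : LieRingModule G0 V where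
  bracket x v := ι (G0.toG x) • v
  add_lie x y v := by
    change ι (G0.toG (x + y)) • v = ι (G0.toG x) • v + ι (G0.toG y) • v
    rw [map_add, map_add, add_smul]
  lie_add x v w := smul_add _ v w
  leibniz_lie x y v := by
    change ι (G0.toG x) • ι (G0.toG y) • v =
      ι (G0.toG ⁅x, y⁆) • v + ι (G0.toG y) • ι (G0.toG x) • v
    rw [ι_lie, sub_smul, mul_smul, mul_smul, sub_add_cancel]

instance : LieModule ℂ G0 V where
  smul_lie a x v := by
    change ι (G0.toG (a • x)) • v = a • ι (G0.toG x) • v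
    rw [map_smul, map_smul, smul_assoc]
  lie_smul a x v := by
    change ι (G0.toG x) • a • v = a • ι (G0.toG x) • v
    rw [← algebraMap_smul U a v,
      ← algebraMap_smul U a (ι (G0.toG x) • v), smul_smul, smul_smul, Algebra.commutes]

/-- The weight space `V_μ = {v | h v = μ(h) v for all h ∈ H}`. -/
def weightSpace (μ : Module.Dual ℂ H) : Submodule ℂ V where
  carrier := {v | ∀ h : H, ι h.1 • v = μ h • v}
  add_mem' := by
    intro v w hv hw h
    rw [smul_add, smul_add, hv h, hw h]
  zero_mem' := by
    intro h
    rw [smul_zero, smul_zero]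
  smul_mem' := by
    intro a v hv h
    rw [smul_comm (μ h) a v, ← hv h, ← algebraMap_smul U a v,
      ← algebraMap_smul U a (ι h.1 • v), smul_smul, smul_smul, Algebra.commutes]

open scoped Classical in
/-- Weight modules: direct sums of finite dimensional weight spaces. -/
def IsWeightModule : Prop :=
  DirectSum.IsInternal (fun μ : Module.Dual ℂ H => weightSpace V μ) ∧
    ∀ μ : Module.Dual ℂ H, FiniteDimensional ℂ (weightSpace V μ)

end Modules

/-- An indecomposable `G`-module. -/
def IsIndecomposable (V : Type*) [AddCommGroup V] [Module U V] : Prop :=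
  Nontrivial V ∧ ∀ A B : Submodule U V, IsCompl A B → A = ⊥ ∨ B = ⊥

/-- An indecomposable `G₀`-module. -/
def IsIndecomposableG0 (W : Type*) [AddCommGroup W] [Module ℂ W] [LieRingModule G0 W]
    [LieModule ℂ G0 W] : Prop :=
  Nontrivial W ∧ ∀ A B : LieSubmodule ℂ G0 W, IsCompl A B → A = ⊥ ∨ B = ⊥

section Induced

variable (W : Type*) [AddCommGroup W] [Module ℂ W] [LieRingModule G0 W] [LieModule ℂ G0 W]

/-- The relations `u x ⊗ w = u ⊗ x w` (`x ∈ G₀`) and `u y ⊗ w = 0` (`y ∈ G₊₁`) in `U(G) ⊗ W`, as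
the left `U(G)`-submodule which they generate. Since `G₀` and `G₊₁` generate the algebra
`U(G₀ ⊕ G₊₁)`, they identify `u p ⊗ w` with `u ⊗ p w` for all `p` in this algebra, where
`G₊₁` acts on `W` by zero. -/
def inducedRelations : Submodule U (U ⊗[ℂ] W) :=
  Submodule.span U
    ({t | ∃ (x : G0) (w : W), t = ι (G0.toG x) ⊗ₜ[ℂ] w - (1 : U) ⊗ₜ[ℂ] ⁅x, w⁆} ∪
      {t | ∃ (y : Gplus) (w : W), t = ι y.1 ⊗ₜ[ℂ] w})

/-- The induced module `U(G) ⊗_{U(G₀ ⊕ G₊₁)} W`, where `G₊₁` acts on `W` by zero. -/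
def Induced : Type _ := (U ⊗[ℂ] W) ⧸ inducedRelations W

instance : AddCommGroup (Induced W) :=
  inferInstanceAs (AddCommGroup ((U ⊗[ℂ] W) ⧸ inducedRelations W))

instance : Module U (Induced W) :=
  inferInstanceAs (Module U ((U ⊗[ℂ] W) ⧸ inducedRelations W))

instance : Module ℂ (Induced W) :=
  inferInstanceAs (Module ℂ ((U ⊗[ℂ] W) ⧸ inducedRelations W))

instance : IsScalarTower ℂ U (Induced W) :=
  inferInstanceAs (IsScalarTower ℂ U ((U ⊗[ℂ] W) ⧸ inducedRelations W))

/-- The canonical map `W → Ind W`, `w ↦ 1 ⊗ w`. -/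
def Induced.of : W →ₗ[ℂ] Induced W where
  toFun w := (inducedRelations W).mkQ ((1 : U) ⊗ₜ[ℂ] w)
  map_add' v w := by
    rw [TensorProduct.tmul_add, map_add]
    rfl
  map_smul' a w := by
    rw [TensorProduct.tmul_smul]
    rfl

/-- The induced module is typical: every submodule which meets `W` trivially is zero. -/
def IsTypical : Prop :=
  ∀ N : Submodule U (Induced W),
    N.restrictScalars ℂ ⊓ LinearMap.range (Induced.of W) = ⊥ → N = ⊥

end Induced

end SL21

end

/-! Write `P`, `R`, `E`, `F` for the basis of `G₀`, `x₁`, `x₂` for that of `G₊₁` and `y₁`, `y₂` for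
that of `G₋₁ = ⟨E₃₁, E₃₂⟩`. The proof rests on the quadratic Casimir element `C` (`casimir`). It
commutes with all of `G`, and if `G₊₁` kills `v`, then `x₁ x₂ y₂ y₁ v = C v`.

Typicality makes `C` injective on `W`: if `C w = 0`, then `y₂ y₁ w` generates a submodule that
misses `W`, hence is zero, and `w = 0` because the induced module is free over the exterior algebra
of `G₋₁` (`IsTypical.eq_zero_of_casimir_smul`). On `V`, `C` preserves the finite dimensional weight
spaces, so by indecomposability it has a single generalized eigenvalue. That eigenvalue is nonzero
because of `W`, so `C` is bijective on `V` (`IsTypical.casimir_bijective`).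

Let `M` be the space of vectors killed by `G₊₁`. Invertibility of `C` gives `V = M ⊕ y₁ M ⊕ y₂ M ⊕
y₂ y₁ M` (`kacSpan_invariants`, `eq_zero_of_sum_eq_zero`), so `V` is induced from `M`. A splitting
of `M` would split `V`, so `M` is indecomposable.

Finally `M` is the largest indecomposable `G₀`-submodule containing `W` (`le_invariants`). The
central element `P + R` of `G₀` has one generalized eigenvalue `c` on `M`, hence `c + 1` on `y₁ M`
and `y₂ M`, and `c + 2` on `y₂ y₁ M`. On an indecomposable `G₀`-submodule containing `W` it also has
one generalized eigenvalue, which must be `c`, and this forces the submodule into `M`. -/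

noncomputable section

namespace SL21

/-! ### Generators and relations of `U(G)`. -/

/-- The relations between the matrices `E₁₁ + E₃₃`, `E₂₂ + E₃₃`, `E₁₂`, `E₂₁`, `E₁₃`, `E₂₃`, `E₃₁`,
`E₃₂` in the enveloping algebra of `sl(2/1)`, for eight elements of a ring. -/
structure Relations {A : Type*} [Ring A] (P R E F x₁ x₂ y₁ y₂ : A) : Prop where
  PR : P * R = R * P
  PE : P * E = E * P + E
  RE : R * E = E * R - E
  PF : P * F = F * P - F
  RF : R * F = F * R + F
  EF : E * F = F * E + P - R
  Px₁ : P * x₁ = x₁ * P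
  Px₂ : P * x₂ = x₂ * P - x₂
  Rx₁ : R * x₁ = x₁ * R - x₁
  Rx₂ : R * x₂ = x₂ * R
  Ex₁ : E * x₁ = x₁ * E
  Ex₂ : E * x₂ = x₂ * E + x₁
  Fx₁ : F * x₁ = x₁ * F + x₂
  Fx₂ : F * x₂ = x₂ * F
  Py₁ : P * y₁ = y₁ * P
  Py₂ : P * y₂ = y₂ * P + y₂
  Ry₁ : R * y₁ = y₁ * R + y₁
  Ry₂ : R * y₂ = y₂ * R
  Ey₁ : E * y₁ = y₁ * E - y₂
  Ey₂ : E * y₂ = y₂ * E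
  Fy₁ : F * y₁ = y₁ * F
  Fy₂ : F * y₂ = y₂ * F - y₁
  x₁x₁ : x₁ * x₁ = 0
  x₂x₂ : x₂ * x₂ = 0
  x₂x₁ : x₂ * x₁ = -(x₁ * x₂)
  y₁y₁ : y₁ * y₁ = 0
  y₂y₂ : y₂ * y₂ = 0
  y₁y₂ : y₁ * y₂ = -(y₂ * y₁)
  x₁y₁ : x₁ * y₁ = P - y₁ * x₁
  x₁y₂ : x₁ * y₂ = E - y₂ * x₁
  x₂y₁ : x₂ * y₁ = F - y₁ * x₂
  x₂y₂ : x₂ * y₂ = R - y₂ * x₂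

theorem isHomogeneous_one_iff {A : M3} :
    IsHomogeneous 1 A ↔ A 0 0 = 0 ∧ A 0 1 = 0 ∧ A 1 0 = 0 ∧ A 1 1 = 0 ∧ A 2 2 = 0 := by
  have e0 : idxParity 0 = 0 := rfl
  have e1 : idxParity 1 = 0 := rfl
  have e2 : idxParity 2 = 1 := rfl
  have n : (1 : ZMod 2) + 1 = 0 := rfl
  have n01 : (0 : ZMod 2) ≠ 1 := by decide
  simp only [IsHomogeneous, ← Matrix.ext_iff, Fin.forall_fin_succ, component, Matrix.of_apply,
    Fin.succ_zero_eq_one, Fin.succ_one_eq_two, IsEmpty.forall_iff, and_true, e0, e1, e2, n,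
    add_zero, zero_add, n01, if_true, if_false, true_and, eq_comm (a := (0 : ℂ)), and_assoc]

/-- The even element of `sl(2/1)` with upper left block `!![a, b; c, d]`. -/
def even (a b c d : ℂ) : G0 :=
  ⟨!![a, b, 0; c, d, 0; 0, 0, a + d], by simp [G, supertrace], by simp [isHomogeneous_zero_iff]⟩

/-- The odd element of `sl(2/1)` with upper right block `!![a; b]` and lower left block
`!![c, d]`. -/
def odd (a b c d : ℂ) : G :=
  ⟨!![0, 0, a; 0, 0, b; c, d, 0], by simp [G, supertrace]⟩

theorem even_isHomogeneous (a b c d : ℂ) : IsHomogeneous 0 (G0.toG (even a b c d)).1 :=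
  (even a b c d).2.2

theorem odd_isHomogeneous (a b c d : ℂ) : IsHomogeneous 1 (odd a b c d).1 := by
  simp [isHomogeneous_one_iff, odd]

theorem G_apply_two_two (g : G) : g.1 2 2 = g.1 0 0 + g.1 1 1 := by
  have h : g.1 0 0 + g.1 1 1 - g.1 2 2 = 0 := g.2
  linear_combination -h

/-- The image of `E₁₁ + E₃₃` in `U(G)`. -/
def uP : U := ι (G0.toG (even 1 0 0 0))

/-- The image of `E₂₂ + E₃₃` in `U(G)`. -/
def uR : U := ι (G0.toG (even 0 0 0 1))

/-- The image of `E₁₂` in `U(G)`. -/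
def uE : U := ι (G0.toG (even 0 1 0 0))

/-- The image of `E₂₁` in `U(G)`. -/
def uF : U := ι (G0.toG (even 0 0 1 0))

/-- The image of `E₁₃` in `U(G)`. -/
def ux₁ : U := ι (odd 1 0 0 0)

/-- The image of `E₂₃` in `U(G)`. -/
def ux₂ : U := ι (odd 0 1 0 0)

/-- The image of `E₃₁` in `U(G)`. -/
def uy₁ : U := ι (odd 0 0 1 0)

/-- The image of `E₃₂` in `U(G)`. -/
def uy₂ : U := ι (odd 0 0 0 1)

theorem ι_even (a b c d : ℂ) :
    ι (G0.toG (even a b c d)) = a • uP + b • uE + c • uF + d • uR := by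
  simp only [uP, uE, uF, uR, ← map_smul, ← map_add]
  congr 2
  apply Subtype.ext
  ext i j
  fin_cases i <;> fin_cases j <;> simp [even]

theorem ι_odd (a b c d : ℂ) :
    ι (odd a b c d) = a • ux₁ + b • ux₂ + c • uy₁ + d • uy₂ := by
  simp only [ux₁, ux₂, uy₁, uy₂, ← map_smul, ← map_add]
  congr 1
  apply Subtype.ext
  ext i j
  fin_cases i <;> fin_cases j <;> simp [odd]

theorem eq_even_add_odd (g : G) :
    g = G0.toG (even (g.1 0 0) (g.1 0 1) (g.1 1 0) (g.1 1 1)) +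
      odd (g.1 0 2) (g.1 1 2) (g.1 2 0) (g.1 2 1) := by
  apply Subtype.ext
  ext i j
  fin_cases i <;> fin_cases j <;> simp [odd, even, G0.toG, G_apply_two_two]

theorem ι_eq (g : G) :
    ι g = (g.1 0 0 • uP + g.1 0 1 • uE + g.1 1 0 • uF + g.1 1 1 • uR) +
      (g.1 0 2 • ux₁ + g.1 1 2 • ux₂ + g.1 2 0 • uy₁ + g.1 2 1 • uy₂) := by
  conv_lhs => rw [eq_even_add_odd g, map_add, ι_even, ι_odd]

theorem superBracket_even_even (a b c d a' b' c' d' : ℂ) :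
    superBracket (G0.toG (even a b c d)) (G0.toG (even a' b' c' d')) =
      G0.toG (even (b * c' - b' * c) (a * b' + b * d' - a' * b - b' * d)
        (c * a' + d * c' - c' * a - d' * c) (c * b' - c' * b)) := by
  apply Subtype.ext
  change superBracketMatrix _ _ = _
  rw [superBracketMatrix_of_homogeneous (even_isHomogeneous ..) (even_isHomogeneous ..)]
  ext i j
  fin_cases i <;> fin_cases j <;>
    simp [even, G0.toG, koszulSign] <;> ring

theorem superBracket_even_odd (a b c d a' b' c' d' : ℂ) :
    superBracket (G0.toG (even a b c d)) (odd a' b' c' d') =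
      odd (a * a' + b * b' - a' * (a + d)) (c * a' + d * b' - b' * (a + d))
        ((a + d) * c' - c' * a - d' * c) ((a + d) * d' - c' * b - d' * d) := by
  apply Subtype.ext
  change superBracketMatrix _ _ = _
  rw [superBracketMatrix_of_homogeneous (even_isHomogeneous ..) (odd_isHomogeneous ..)]
  ext i j
  fin_cases i <;> fin_cases j <;>
    simp [even, odd, G0.toG, koszulSign, sub_sub]

theorem superBracket_odd_odd (a b c d a' b' c' d' : ℂ) :
    superBracket (odd a b c d) (odd a' b' c' d') =
      G0.toG (even (a * c' + a' * c) (a * d' + a' * d) (b * c' + b' * c) (b * d' + b' * d)) := by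
  have v1 : (1 : ZMod 2).val = 1 := rfl
  apply Subtype.ext
  change superBracketMatrix _ _ = _
  rw [superBracketMatrix_of_homogeneous (odd_isHomogeneous ..) (odd_isHomogeneous ..)]
  ext i j
  fin_cases i <;> fin_cases j <;>
    simp [even, odd, G0.toG, koszulSign, v1] <;> ring

theorem even_mul_even (a b c d a' b' c' d' : ℂ) :
    ι (G0.toG (even a b c d)) * ι (G0.toG (even a' b' c' d')) =
      ι (G0.toG (even a' b' c' d')) * ι (G0.toG (even a b c d)) +
        ((b * c' - b' * c) • uP + (a * b' + b * d' - a' * b - b' * d) • uE +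
          (c * a' + d * c' - c' * a - d' * c) • uF + (c * b' - c' * b) • uR) := by
  rw [ι_mul_ι (even_isHomogeneous ..) (even_isHomogeneous ..), superBracket_even_even,
    ι_even (b * c' - b' * c)]
  simp [koszulSign]

theorem even_mul_odd (a b c d a' b' c' d' : ℂ) :
    ι (G0.toG (even a b c d)) * ι (odd a' b' c' d') =
      ι (odd a' b' c' d') * ι (G0.toG (even a b c d)) +
        ((a * a' + b * b' - a' * (a + d)) • ux₁ + (c * a' + d * b' - b' * (a + d)) • ux₂ +
          ((a + d) * c' - c' * a - d' * c) • uy₁ + ((a + d) * d' - c' * b - d' * d) • uy₂) := by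
  rw [ι_mul_ι (even_isHomogeneous ..) (odd_isHomogeneous ..), superBracket_even_odd,
    ι_odd (a * a' + b * b' - a' * (a + d))]
  simp [koszulSign]

theorem odd_mul_odd (a b c d a' b' c' d' : ℂ) :
    ι (odd a b c d) * ι (odd a' b' c' d') =
      -(ι (odd a' b' c' d') * ι (odd a b c d)) +
        ((a * c' + a' * c) • uP + (a * d' + a' * d) • uE + (b * c' + b' * c) • uF +
          (b * d' + b' * d) • uR) := by
  have v1 : (1 : ZMod 2).val = 1 := rfl
  rw [ι_mul_ι (odd_isHomogeneous ..) (odd_isHomogeneous ..), superBracket_odd_odd, ι_even]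
  simp [koszulSign, v1]

theorem odd_mul_self (a b c d : ℂ) (h₀ : a * c = 0) (h₁ : a * d = 0) (h₂ : b * c = 0)
    (h₃ : b * d = 0) : ι (odd a b c d) * ι (odd a b c d) = 0 := by
  have h := odd_mul_odd a b c d a b c d
  simp only [h₀, h₁, h₂, h₃, add_zero, zero_smul] at h
  -- The superbracket of an odd element with itself is twice its square.
  have : (2 : ℂ) • (ι (odd a b c d) * ι (odd a b c d)) = 0 := by
    rw [two_smul]
    exact add_eq_zero_iff_eq_neg.2 h
  exact (smul_eq_zero_iff_right two_ne_zero).1 this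

theorem relations_U : Relations uP uR uE uF ux₁ ux₂ uy₁ uy₂ where
  PR := (even_mul_even ..).trans (by simp [uP, uR])
  PE := (even_mul_even ..).trans (by simp [uP, uE])
  RE := (even_mul_even ..).trans (by simp [uR, uE, sub_eq_add_neg])
  PF := (even_mul_even ..).trans (by simp [uP, uF, sub_eq_add_neg])
  RF := (even_mul_even ..).trans (by simp [uR, uF])
  EF := (even_mul_even ..).trans (by
    simp [uE, uF, uP, uR, sub_eq_add_neg, add_assoc])
  Px₁ := (even_mul_odd ..).trans (by simp [uP, ux₁])
  Px₂ := (even_mul_odd ..).trans (by simp [uP, ux₂, sub_eq_add_neg])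
  Rx₁ := (even_mul_odd ..).trans (by simp [uR, ux₁, sub_eq_add_neg])
  Rx₂ := (even_mul_odd ..).trans (by simp [uR, ux₂])
  Ex₁ := (even_mul_odd ..).trans (by simp [uE, ux₁])
  Ex₂ := (even_mul_odd ..).trans (by simp [uE, ux₂, ux₁])
  Fx₁ := (even_mul_odd ..).trans (by simp [uF, ux₁, ux₂])
  Fx₂ := (even_mul_odd ..).trans (by simp [uF, ux₂])
  Py₁ := (even_mul_odd ..).trans (by simp [uP, uy₁])
  Py₂ := (even_mul_odd ..).trans (by simp [uP, uy₂])
  Ry₁ := (even_mul_odd ..).trans (by simp [uR, uy₁])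
  Ry₂ := (even_mul_odd ..).trans (by simp [uR, uy₂])
  Ey₁ := (even_mul_odd ..).trans (by simp [uE, uy₁, uy₂, sub_eq_add_neg])
  Ey₂ := (even_mul_odd ..).trans (by simp [uE, uy₂])
  Fy₁ := (even_mul_odd ..).trans (by simp [uF, uy₁])
  Fy₂ := (even_mul_odd ..).trans (by simp [uF, uy₁, uy₂, sub_eq_add_neg])
  x₁x₁ := odd_mul_self _ _ _ _ (by simp) (by simp) (by simp) (by simp)
  x₂x₂ := odd_mul_self _ _ _ _ (by simp) (by simp) (by simp) (by simp)
  x₂x₁ := (odd_mul_odd ..).trans (by simp [ux₁, ux₂])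
  y₁y₁ := odd_mul_self _ _ _ _ (by simp) (by simp) (by simp) (by simp)
  y₂y₂ := odd_mul_self _ _ _ _ (by simp) (by simp) (by simp) (by simp)
  y₁y₂ := (odd_mul_odd ..).trans (by simp [uy₁, uy₂])
  x₁y₁ := (odd_mul_odd ..).trans (by rw [neg_add_eq_sub]; simp [ux₁, uy₁])
  x₁y₂ := (odd_mul_odd ..).trans (by rw [neg_add_eq_sub]; simp [ux₁, uy₂])
  x₂y₁ := (odd_mul_odd ..).trans (by rw [neg_add_eq_sub]; simp [ux₂, uy₁])
  x₂y₂ := (odd_mul_odd ..).trans (by rw [neg_add_eq_sub]; simp [ux₂, uy₂])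

theorem eq_even_of_isHomogeneous {g : G} (h : IsHomogeneous 0 g.1) :
    ∃ a b c d, g = G0.toG (even a b c d) := by
  rw [isHomogeneous_zero_iff] at h
  refine ⟨g.1 0 0, g.1 0 1, g.1 1 0, g.1 1 1, (eq_even_add_odd g).trans ?_⟩
  rw [h.1, h.2.1, h.2.2.1, h.2.2.2, add_eq_left]
  apply Subtype.ext
  ext i j
  fin_cases i <;> fin_cases j <;> simp [odd]

theorem eq_odd_of_isHomogeneous {g : G} (h : IsHomogeneous 1 g.1) :
    ∃ a b c d, g = odd a b c d := by
  rw [isHomogeneous_one_iff] at h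
  refine ⟨g.1 0 2, g.1 1 2, g.1 2 0, g.1 2 1, (eq_even_add_odd g).trans ?_⟩
  rw [h.1, h.2.1, h.2.2.1, h.2.2.2.1, add_eq_right]
  apply Subtype.ext
  ext i j
  fin_cases i <;> fin_cases j <;> simp [even, G0.toG]

/-! ### Homomorphisms out of `U(G)`. -/

section Lift

variable {A : Type*} [Ring A] [Algebra ℂ A]

/-- The linear map on `sl(2/1)` with given values on the eight basis elements. -/
def linearLift (P R E F x₁ x₂ y₁ y₂ : A) : G →ₗ[ℂ] A where
  toFun g := (g.1 0 0 • P + g.1 0 1 • E + g.1 1 0 • F + g.1 1 1 • R) +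
      (g.1 0 2 • x₁ + g.1 1 2 • x₂ + g.1 2 0 • y₁ + g.1 2 1 • y₂)
  map_add' g g' := by
    simp only [Submodule.coe_add, Matrix.add_apply]
    module
  map_smul' a g := by
    simp only [Submodule.coe_smul, Matrix.smul_apply, RingHom.id_apply, smul_eq_mul]
    module

theorem linearLift_even (P R E F x₁ x₂ y₁ y₂ : A) (a b c d : ℂ) :
    linearLift P R E F x₁ x₂ y₁ y₂ (G0.toG (even a b c d)) =
      a • P + b • E + c • F + d • R := by
  simp [linearLift, G0.toG, even]

theorem linearLift_odd (P R E F x₁ x₂ y₁ y₂ : A) (a b c d : ℂ) :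
    linearLift P R E F x₁ x₂ y₁ y₂ (odd a b c d) =
      a • x₁ + b • x₂ + c • y₁ + d • y₂ := by
  simp [linearLift, odd]

variable {P R E F x₁ x₂ y₁ y₂ : A}

theorem Relations.bracket_even_even (h : Relations P R E F x₁ x₂ y₁ y₂)
    (a b c d a' b' c' d' : ℂ) :
    linearLift P R E F x₁ x₂ y₁ y₂ (G0.toG (even a b c d)) *
        linearLift P R E F x₁ x₂ y₁ y₂ (G0.toG (even a' b' c' d')) =
      linearLift P R E F x₁ x₂ y₁ y₂ (G0.toG (even a' b' c' d')) *
        linearLift P R E F x₁ x₂ y₁ y₂ (G0.toG (even a b c d)) +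
      linearLift P R E F x₁ x₂ y₁ y₂
        (superBracket (G0.toG (even a b c d)) (G0.toG (even a' b' c' d'))) := by
  simp only [superBracket_even_even, linearLift_even, add_mul, mul_add, smul_mul_smul_comm,
    h.PR, h.PE, h.RE, h.PF, h.RF, h.EF]
  module

theorem Relations.bracket_even_odd (h : Relations P R E F x₁ x₂ y₁ y₂)
    (a b c d a' b' c' d' : ℂ) :
    linearLift P R E F x₁ x₂ y₁ y₂ (G0.toG (even a b c d)) *
        linearLift P R E F x₁ x₂ y₁ y₂ (odd a' b' c' d') =
      linearLift P R E F x₁ x₂ y₁ y₂ (odd a' b' c' d') *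
        linearLift P R E F x₁ x₂ y₁ y₂ (G0.toG (even a b c d)) +
      linearLift P R E F x₁ x₂ y₁ y₂
        (superBracket (G0.toG (even a b c d)) (odd a' b' c' d')) := by
  simp only [superBracket_even_odd, linearLift_even, linearLift_odd, add_mul, mul_add,
    smul_mul_smul_comm, h.Px₁, h.Px₂, h.Rx₁, h.Rx₂, h.Ex₁, h.Ex₂, h.Fx₁, h.Fx₂,
    h.Py₁, h.Py₂, h.Ry₁, h.Ry₂, h.Ey₁, h.Ey₂, h.Fy₁, h.Fy₂]
  module

theorem Relations.bracket_odd_odd (h : Relations P R E F x₁ x₂ y₁ y₂)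
    (a b c d a' b' c' d' : ℂ) :
    linearLift P R E F x₁ x₂ y₁ y₂ (odd a b c d) *
        linearLift P R E F x₁ x₂ y₁ y₂ (odd a' b' c' d') =
      -(linearLift P R E F x₁ x₂ y₁ y₂ (odd a' b' c' d') *
        linearLift P R E F x₁ x₂ y₁ y₂ (odd a b c d)) +
      linearLift P R E F x₁ x₂ y₁ y₂ (superBracket (odd a b c d) (odd a' b' c' d')) := by
  simp only [superBracket_odd_odd, linearLift_even, linearLift_odd, add_mul, mul_add,
    smul_mul_smul_comm, h.x₁x₁, h.x₂x₂, h.x₂x₁, h.y₁y₁, h.y₂y₂, h.y₁y₂,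
    h.x₁y₁, h.x₁y₂, h.x₂y₁, h.x₂y₂]
  module

theorem Relations.bracket (h : Relations P R E F x₁ x₂ y₁ y₂) (p q : ZMod 2) (g g' : G)
    (hg : IsHomogeneous p g.1) (hg' : IsHomogeneous q g'.1) :
    linearLift P R E F x₁ x₂ y₁ y₂ g * linearLift P R E F x₁ x₂ y₁ y₂ g' =
      koszulSign p q •
        (linearLift P R E F x₁ x₂ y₁ y₂ g' * linearLift P R E F x₁ x₂ y₁ y₂ g) +
      linearLift P R E F x₁ x₂ y₁ y₂ (superBracket g g') := by
  have v1 : (1 : ZMod 2).val = 1 := rfl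
  have hp : ∀ p : ZMod 2, p = 0 ∨ p = 1 := by decide
  rcases hp p with rfl | rfl <;> rcases hp q with rfl | rfl
  · obtain ⟨a, b, c, d, rfl⟩ := eq_even_of_isHomogeneous hg
    obtain ⟨a', b', c', d', rfl⟩ := eq_even_of_isHomogeneous hg'
    simpa [koszulSign] using h.bracket_even_even a b c d a' b' c' d'
  · obtain ⟨a, b, c, d, rfl⟩ := eq_even_of_isHomogeneous hg
    obtain ⟨a', b', c', d', rfl⟩ := eq_odd_of_isHomogeneous hg'
    simpa [koszulSign] using h.bracket_even_odd a b c d a' b' c' d'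
  · obtain ⟨a, b, c, d, rfl⟩ := eq_odd_of_isHomogeneous hg
    obtain ⟨a', b', c', d', rfl⟩ := eq_even_of_isHomogeneous hg'
    -- The odd-even case follows from the even-odd case, since the superbracket is antisymmetric
    -- when one argument is even.
    have key : superBracket (odd a b c d) (G0.toG (even a' b' c' d')) =
        -superBracket (G0.toG (even a' b' c' d')) (odd a b c d) := by
      apply Subtype.ext
      change superBracketMatrix _ _ = - superBracketMatrix _ _
      rw [superBracketMatrix_of_homogeneous hg hg', superBracketMatrix_of_homogeneous hg' hg]
      simp [koszulSign]
    rw [key, map_neg, h.bracket_even_odd]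
    simp [koszulSign]
  · obtain ⟨a, b, c, d, rfl⟩ := eq_odd_of_isHomogeneous hg
    obtain ⟨a', b', c', d', rfl⟩ := eq_odd_of_isHomogeneous hg'
    simpa [koszulSign, v1] using h.bracket_odd_odd a b c d a' b' c' d'

/-- Eight elements which satisfy the relations define a homomorphism on `U(G)`. -/
def Relations.lift (h : Relations P R E F x₁ x₂ y₁ y₂) : U →ₐ[ℂ] A :=
  RingQuot.liftAlgHom ℂ ⟨TensorAlgebra.lift ℂ (linearLift P R E F x₁ x₂ y₁ y₂), by
    rintro _ _ ⟨p, q, g, g', hg, hg'⟩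
    simpa using h.bracket p q g g' hg hg'⟩

theorem Relations.lift_ι (h : Relations P R E F x₁ x₂ y₁ y₂) (g : G) :
    h.lift (ι g) = linearLift P R E F x₁ x₂ y₁ y₂ g :=
  (RingQuot.liftAlgHom_mkAlgHom_apply ..).trans (TensorAlgebra.lift_ι_apply ..)

end Lift

/-! ### Locally finite operators and generalized eigenspaces. -/

section LocallyFinite

variable {V : Type*} [AddCommGroup V] [Module ℂ V]

/-- Every vector lies in a finite dimensional subspace which is stable under `T`. -/
def IsLocallyFinite (T : Module.End ℂ V) : Prop :=
  ∀ v, ∃ F : Submodule ℂ V, FiniteDimensional ℂ F ∧ v ∈ F ∧ ∀ w ∈ F, T w ∈ F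

variable {T : Module.End ℂ V}

theorem IsLocallyFinite.iSup_maxGenEigenspace_eq_top (hT : IsLocallyFinite T) :
    ⨆ μ, T.maxGenEigenspace μ = ⊤ := by
  refine eq_top_iff.2 fun v _ => ?_
  obtain ⟨F, hF, hv, hTF⟩ := hT v
  let T' : Module.End ℂ F := T.restrict hTF
  have h : (⟨v, hv⟩ : F) ∈ ⨆ μ, T'.maxGenEigenspace μ := by
    rw [Module.End.iSup_maxGenEigenspace_eq_top]
    trivial
  have h' := Submodule.mem_map_of_mem (f := F.subtype) h
  rw [Submodule.map_iSup] at h'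
  refine iSup_mono (f := fun μ => (T'.maxGenEigenspace μ).map F.subtype) (fun μ => ?_) h'
  rintro _ ⟨w, hw, rfl⟩
  rw [SetLike.mem_coe, Module.End.mem_maxGenEigenspace] at hw
  rw [Module.End.mem_maxGenEigenspace]
  obtain ⟨k, hk⟩ := hw
  refine ⟨k, ?_⟩
  have key : ∀ (k : ℕ) (w : F),
      (((T' - μ • 1) ^ k) w : V) = ((T - μ • 1) ^ k) (w : V) := by
    intro k
    induction k with
    | zero => simp
    | succ k ih =>
      intro w
      rw [pow_succ, pow_succ, Module.End.mul_apply, Module.End.mul_apply, ih]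
      rfl
  rw [Submodule.subtype_apply, ← key, hk, Submodule.coe_zero]

/-- An injective operator is surjective on each finite dimensional stable subspace. -/
theorem IsLocallyFinite.surjective (hT : IsLocallyFinite T) (h : Function.Injective T) :
    Function.Surjective T := by
  intro v
  obtain ⟨F, hF, hv, hTF⟩ := hT v
  have hinj : Function.Injective (T.restrict hTF) := by
    intro a b hab
    exact Subtype.ext (h (congrArg Subtype.val hab))
  obtain ⟨w, hw⟩ := LinearMap.surjective_of_injective hinj ⟨v, hv⟩
  exact ⟨w, congrArg Subtype.val hw⟩

theorem IsLocallyFinite.restrict (hT : IsLocallyFinite T) {S : Submodule ℂ V}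
    {T' : Module.End ℂ S} (h : ∀ s, (T' s : V) = T s) : IsLocallyFinite T' := by
  intro v
  obtain ⟨F, hF, hv, hTF⟩ := hT v
  refine ⟨F.comap S.subtype, ?_, hv, fun w hw => ?_⟩
  · exact Module.Finite.of_injective
      ((S.subtype.restrict (p := F.comap S.subtype) (q := F) fun _ hx => hx))
      (fun a b hab => Subtype.ext (Subtype.ext (congrArg (fun x : F => (x : V)) hab)))
  · rw [Submodule.mem_comap, Submodule.subtype_apply, h]
    exact hTF _ hw

/-- A locally finite operator on an indecomposable module which commutes with the action has only
one generalized eigenvalue. -/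
theorem IsLocallyFinite.exists_maxGenEigenspace_eq_top [Nontrivial V] (hT : IsLocallyFinite T)
    (S : Set (Module.End ℂ V)) (hS : ∀ s ∈ S, Commute T s)
    (hV : ∀ A B : Submodule ℂ V, (∀ s ∈ S, ∀ a ∈ A, s a ∈ A) → (∀ s ∈ S, ∀ b ∈ B, s b ∈ B) →
      IsCompl A B → A = ⊥ ∨ B = ⊥) :
    ∃ μ, T.maxGenEigenspace μ = ⊤ := by
  have hst : ∀ μ, ∀ s ∈ S, ∀ a ∈ T.maxGenEigenspace μ, s a ∈ T.maxGenEigenspace μ :=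
    fun μ s hs a ha => Module.End.mapsTo_maxGenEigenspace_of_comm (hS s hs) μ ha
  obtain ⟨μ, hμ⟩ : ∃ μ, T.maxGenEigenspace μ ≠ ⊥ := by
    by_contra! h
    have := hT.iSup_maxGenEigenspace_eq_top
    simp only [h, iSup_bot] at this
    exact bot_ne_top this
  refine ⟨μ, ?_⟩
  -- The sum of the other generalized eigenspaces is an `S`-stable complement, so indecomposability
  -- makes it vanish.
  have hc : IsCompl (T.maxGenEigenspace μ) (⨆ ν, ⨆ _ : ν ≠ μ, T.maxGenEigenspace ν) := by
    refine ⟨T.independent_maxGenEigenspace μ, codisjoint_iff.2 ?_⟩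
    rw [eq_top_iff, ← hT.iSup_maxGenEigenspace_eq_top]
    refine iSup_le fun ν => ?_
    by_cases h : ν = μ
    · rw [h]
      exact le_sup_left
    · exact le_sup_of_le_right (le_iSup₂_of_le ν h le_rfl)
  have hst' : ∀ s ∈ S, ∀ b ∈ ⨆ ν, ⨆ _ : ν ≠ μ, T.maxGenEigenspace ν,
      s b ∈ ⨆ ν, ⨆ _ : ν ≠ μ, T.maxGenEigenspace ν := by
    intro s hs
    change (⨆ ν, ⨆ _ : ν ≠ μ, T.maxGenEigenspace ν) ≤
      (⨆ ν, ⨆ _ : ν ≠ μ, T.maxGenEigenspace ν).comap s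
    refine iSup₂_le fun ν h a ha => ?_
    exact Submodule.mem_iSup_of_mem ν (Submodule.mem_iSup_of_mem h (hst ν s hs a ha))
  rcases hV _ _ (hst μ) hst' hc with h | h
  · exact absurd h hμ
  · rw [h] at hc
    exact eq_top_of_isCompl_bot hc

end LocallyFinite

section Weights

variable {V : Type*} [AddCommGroup V] [Module ℂ V] [Module U V] [IsScalarTower ℂ U V]

/-- An operator that commutes with `H` preserves each weight space, and every vector lies in a
finite, hence finite dimensional, sum of these. -/
theorem IsWeightModule.isLocallyFinite (hV : IsWeightModule V) {T : Module.End ℂ V}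
    (hT : ∀ (h : H) (v : V), T (ι h.1 • v) = ι h.1 • T v) : IsLocallyFinite T := by
  classical
  intro v
  have hv : v ∈ ⨆ μ, weightSpace V μ := by
    have := hV.1.submodule_iSup_eq_top
    rw [this]
    trivial
  obtain ⟨s, hs⟩ := Submodule.mem_iSup_iff_exists_finset.1 hv
  have := hV.2
  have hfin : FiniteDimensional ℂ ↥(⨆ μ ∈ s, weightSpace V μ) := by
    rw [← Finset.sup_eq_iSup]
    exact Submodule.finite_finset_sup _ _
  refine ⟨⨆ μ ∈ s, weightSpace V μ, hfin, hs, fun w hw => ?_⟩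
  suffices h : (⨆ μ ∈ s, weightSpace V μ) ≤ (⨆ μ ∈ s, weightSpace V μ).comap T from h hw
  refine iSup₂_le fun μ hμ a ha => ?_
  refine Submodule.mem_iSup_of_mem μ (Submodule.mem_iSup_of_mem hμ fun h => ?_)
  rw [← hT, ha h, map_smul]

end Weights

/-! ### Reordering products of basis elements, and the Casimir element. -/

section Action

variable {V : Type*} [AddCommGroup V] [Module U V]

/-- As rewrite rules, this and the next four lemmas bring products into the PBW order `y₂ y₁ x₁ x₂ F
E R P`; identities in `U(G)` then become additive ones, closed by `abel`. -/
theorem even_smul_even :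
    (∀ v : V, uP • uR • v = uR • uP • v) ∧ (∀ v : V, uP • uE • v = uE • uP • v + uE • v) ∧
    (∀ v : V, uR • uE • v = uE • uR • v - uE • v) ∧
    (∀ v : V, uP • uF • v = uF • uP • v - uF • v) ∧
    (∀ v : V, uR • uF • v = uF • uR • v + uF • v) ∧
    (∀ v : V, uE • uF • v = uF • uE • v + uP • v - uR • v) := by
  obtain h := relations_U
  simp only [← mul_smul, h.PR, h.PE, h.RE, h.PF, h.RF, h.EF, add_smul, sub_smul, implies_true,
    and_self]

theorem even_smul_x :
    (∀ v : V, uP • ux₁ • v = ux₁ • uP • v) ∧ (∀ v : V, uP • ux₂ • v = ux₂ • uP • v - ux₂ • v) ∧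
    (∀ v : V, uR • ux₁ • v = ux₁ • uR • v - ux₁ • v) ∧ (∀ v : V, uR • ux₂ • v = ux₂ • uR • v) ∧
    (∀ v : V, uE • ux₁ • v = ux₁ • uE • v) ∧ (∀ v : V, uE • ux₂ • v = ux₂ • uE • v + ux₁ • v) ∧
    (∀ v : V, uF • ux₁ • v = ux₁ • uF • v + ux₂ • v) ∧
    (∀ v : V, uF • ux₂ • v = ux₂ • uF • v) := by
  obtain h := relations_U
  simp only [← mul_smul, h.Px₁, h.Px₂, h.Rx₁, h.Rx₂, h.Ex₁, h.Ex₂, h.Fx₁, h.Fx₂, add_smul,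
    sub_smul, implies_true, and_self]

theorem even_smul_y :
    (∀ v : V, uP • uy₁ • v = uy₁ • uP • v) ∧ (∀ v : V, uP • uy₂ • v = uy₂ • uP • v + uy₂ • v) ∧
    (∀ v : V, uR • uy₁ • v = uy₁ • uR • v + uy₁ • v) ∧ (∀ v : V, uR • uy₂ • v = uy₂ • uR • v) ∧
    (∀ v : V, uE • uy₁ • v = uy₁ • uE • v - uy₂ • v) ∧ (∀ v : V, uE • uy₂ • v = uy₂ • uE • v) ∧
    (∀ v : V, uF • uy₁ • v = uy₁ • uF • v) ∧
    (∀ v : V, uF • uy₂ • v = uy₂ • uF • v - uy₁ • v) := by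
  obtain h := relations_U
  simp only [← mul_smul, h.Py₁, h.Py₂, h.Ry₁, h.Ry₂, h.Ey₁, h.Ey₂, h.Fy₁, h.Fy₂, add_smul,
    sub_smul, implies_true, and_self]

theorem x_smul_x :
    (∀ v : V, ux₁ • ux₁ • v = 0) ∧ (∀ v : V, ux₂ • ux₂ • v = 0) ∧
    (∀ v : V, ux₂ • ux₁ • v = -(ux₁ • ux₂ • v)) := by
  obtain h := relations_U
  simp only [← mul_smul, h.x₁x₁, h.x₂x₂, h.x₂x₁, neg_smul, zero_smul, implies_true, and_self]

theorem y_smul_y :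
    (∀ v : V, uy₁ • uy₁ • v = 0) ∧ (∀ v : V, uy₂ • uy₂ • v = 0) ∧
    (∀ v : V, uy₁ • uy₂ • v = -(uy₂ • uy₁ • v)) := by
  obtain h := relations_U
  simp only [← mul_smul, h.y₁y₁, h.y₂y₂, h.y₁y₂, neg_smul, zero_smul, implies_true, and_self]

theorem x_smul_y :
    (∀ v : V, ux₁ • uy₁ • v = uP • v - uy₁ • ux₁ • v) ∧
    (∀ v : V, ux₁ • uy₂ • v = uE • v - uy₂ • ux₁ • v) ∧
    (∀ v : V, ux₂ • uy₁ • v = uF • v - uy₁ • ux₂ • v) ∧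
    (∀ v : V, ux₂ • uy₂ • v = uR • v - uy₂ • ux₂ • v) := by
  obtain h := relations_U
  simp only [← mul_smul, h.x₁y₁, h.x₁y₂, h.x₂y₁, h.x₂y₂, sub_smul, implies_true, and_self]

/-- The opposite ordering, with `G₋₁` moved to the right, for use on vectors killed by `G₋₁`. -/
theorem y_smul_x :
    (∀ v : V, uy₁ • ux₁ • v = uP • v - ux₁ • uy₁ • v) ∧
    (∀ v : V, uy₂ • ux₁ • v = uE • v - ux₁ • uy₂ • v) ∧
    (∀ v : V, uy₁ • ux₂ • v = uF • v - ux₂ • uy₁ • v) ∧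
    (∀ v : V, uy₂ • ux₂ • v = uR • v - ux₂ • uy₂ • v) := by
  simp only [x_smul_y, sub_sub_cancel, implies_true, and_self]

/-- The quadratic Casimir element. -/
def casimir : U := uP * uR + uP - uE * uF - uy₁ * ux₁ - uy₂ * ux₂

theorem casimir_smul (v : V) : casimir • v =
    uP • uR • v + uP • v - uE • uF • v - uy₁ • ux₁ • v - uy₂ • ux₂ • v := by
  simp only [casimir, sub_smul, add_smul, mul_smul]

/-- The Casimir element without its part in `U(G₀)`, up to the left ideal of `G₊₁`. -/
theorem casimir_smul_eq (v : V) : casimir • v = ux₁ • ux₂ • uy₂ • uy₁ • v +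
    (uy₁ • (uR • ux₁ • v + ux₁ • v) - uy₂ • uF • ux₁ • v) - ux₁ • uy₂ • uy₁ • ux₂ • v := by
  simp only [casimir_smul, even_smul_even, even_smul_x, even_smul_y, x_smul_y, smul_add,
    smul_sub]
  abel

/-- Centrality of `C`, checked on generators by comparing PBW normal forms. -/
theorem casimir_smul_basis :
    (∀ v : V, casimir • uP • v = uP • casimir • v) ∧
    (∀ v : V, casimir • uR • v = uR • casimir • v) ∧
    (∀ v : V, casimir • uE • v = uE • casimir • v) ∧
    (∀ v : V, casimir • uF • v = uF • casimir • v) ∧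
    (∀ v : V, casimir • ux₁ • v = ux₁ • casimir • v) ∧
    (∀ v : V, casimir • ux₂ • v = ux₂ • casimir • v) ∧
    (∀ v : V, casimir • uy₁ • v = uy₁ • casimir • v) ∧
    (∀ v : V, casimir • uy₂ • v = uy₂ • casimir • v) := by
  refine ⟨fun v => ?_, fun v => ?_, fun v => ?_, fun v => ?_, fun v => ?_, fun v => ?_,
    fun v => ?_, fun v => ?_⟩ <;>
  · simp only [casimir_smul, even_smul_even, even_smul_x, even_smul_y, x_smul_x, y_smul_y,
      x_smul_y, smul_add, smul_sub, smul_neg, smul_zero]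
    abel

end Action

/-! ### Stable subspaces and the submodules they generate. -/

section Stable

variable {V : Type*} [AddCommGroup V] [Module ℂ V] [Module U V]

/-- A subspace which is stable under the even basis elements. -/
def IsEvenStable (S : Submodule ℂ V) : Prop :=
  ∀ s ∈ S, uP • s ∈ S ∧ uR • s ∈ S ∧ uE • s ∈ S ∧ uF • s ∈ S

/-- A subspace which is stable under the odd basis elements. -/
def IsOddStable (S : Submodule ℂ V) : Prop :=
  ∀ s ∈ S, ux₁ • s ∈ S ∧ ux₂ • s ∈ S ∧ uy₁ • s ∈ S ∧ uy₂ • s ∈ S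

variable [IsScalarTower ℂ U V]

theorem ι_smul (g : G) (v : V) :
    ι g • v = (g.1 0 0 • uP • v + g.1 0 1 • uE • v + g.1 1 0 • uF • v + g.1 1 1 • uR • v) +
      (g.1 0 2 • ux₁ • v + g.1 1 2 • ux₂ • v + g.1 2 0 • uy₁ • v + g.1 2 1 • uy₂ • v) := by
  rw [ι_eq]
  simp only [add_smul, smul_assoc]

theorem ι_toG_smul (g : G0) (v : V) : ι (G0.toG g) • v =
    g.1 0 0 • uP • v + g.1 0 1 • uE • v + g.1 1 0 • uF • v + g.1 1 1 • uR • v := by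
  have h := isHomogeneous_zero_iff.1 g.2.2
  rw [ι_smul]
  simp [G0.toG, h]

theorem ι_smul_commute {T : Module.End ℂ V}
    (hT : (∀ v, T (uP • v) = uP • T v) ∧ (∀ v, T (uR • v) = uR • T v) ∧
      (∀ v, T (uE • v) = uE • T v) ∧ (∀ v, T (uF • v) = uF • T v)) (g : G0) (v : V) :
    T (ι (G0.toG g) • v) = ι (G0.toG g) • T v := by
  simp only [ι_toG_smul, map_add, map_smul, hT]

theorem IsEvenStable.ι_smul_mem {S : Submodule ℂ V} (h : IsEvenStable S) (g : G0) {s : V}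
    (hs : s ∈ S) : ι (G0.toG g) • s ∈ S := by
  obtain ⟨h₁, h₂, h₃, h₄⟩ := h s hs
  rw [ι_toG_smul]
  exact S.add_mem (S.add_mem (S.add_mem (S.smul_mem _ h₁) (S.smul_mem _ h₃)) (S.smul_mem _ h₄))
    (S.smul_mem _ h₂)

theorem isEvenStable_iff {S : Submodule ℂ V} :
    IsEvenStable S ↔ ∀ (g : G0), ∀ s ∈ S, ι (G0.toG g) • s ∈ S :=
  ⟨fun h g _ hs => h.ι_smul_mem g hs, fun h s hs => ⟨h _ s hs, h _ s hs, h _ s hs, h _ s hs⟩⟩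

theorem ι_smul_mem {S : Submodule ℂ V} (h₀ : IsEvenStable S) (h₁ : IsOddStable S) (g : G) {s : V}
    (hs : s ∈ S) : ι g • s ∈ S := by
  obtain ⟨h₁, h₂, h₃, h₄⟩ := h₁ s hs
  rw [eq_even_add_odd g, map_add, add_smul, ι_odd]
  refine S.add_mem (h₀.ι_smul_mem _ hs) ?_
  simp only [add_smul, smul_assoc]
  exact S.add_mem (S.add_mem (S.add_mem (S.smul_mem _ h₁) (S.smul_mem _ h₂)) (S.smul_mem _ h₃))
    (S.smul_mem _ h₄)

theorem U_induction {p : U → Prop} (algebraMap : ∀ a : ℂ, p (algebraMap ℂ U a))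
    (ι : ∀ g, p (ι g)) (mul : ∀ a b, p a → p b → p (a * b)) (add : ∀ a b, p a → p b → p (a + b))
    (u : U) : p u := by
  obtain ⟨t, rfl⟩ := RingQuot.mkAlgHom_surjective ℂ URel u
  induction t using TensorAlgebra.induction with
  | algebraMap a =>
    rw [AlgHom.commutes]
    exact algebraMap a
  | ι g => exact ι g
  | mul a b ha hb =>
    rw [map_mul]
    exact mul _ _ ha hb
  | add a b ha hb =>
    rw [map_add]
    exact add _ _ ha hb

theorem smul_mem_of_ι_smul_mem {S : Submodule ℂ V} (h : ∀ g, ∀ s ∈ S, ι g • s ∈ S) (u : U) :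
    ∀ s ∈ S, u • s ∈ S := by
  induction u using U_induction with
  | algebraMap a =>
    intro s hs
    rw [algebraMap_smul]
    exact S.smul_mem a hs
  | ι g => exact h g
  | mul a b ha hb =>
    intro s hs
    rw [mul_smul]
    exact ha _ (hb s hs)
  | add a b ha hb =>
    intro s hs
    rw [add_smul]
    exact S.add_mem (ha s hs) (hb s hs)

/-- The `U(G)`-submodule given by a subspace which is stable under the basis elements. -/
def toSubmodule (S : Submodule ℂ V) (h₀ : IsEvenStable S) (h₁ : IsOddStable S) :
    Submodule U V where
  carrier := S
  add_mem' := S.add_mem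
  zero_mem' := S.zero_mem
  smul_mem' u _ hs := smul_mem_of_ι_smul_mem (fun g _ hs => ι_smul_mem h₀ h₁ g hs) u _ hs

/-- The endomorphism given by the action of an element of `U(G)`. -/
def actEnd (V : Type*) [AddCommGroup V] [Module ℂ V] [Module U V] [IsScalarTower ℂ U V] (u : U) :
    Module.End ℂ V :=
  Algebra.lsmul ℂ ℂ V u

@[simp]
theorem actEnd_apply (u : U) (v : V) : actEnd V u v = u • v :=
  rfl

theorem casimir_smul_ι_smul (g : G) (v : V) : casimir • ι g • v = ι g • casimir • v := by
  have comm (a : ℂ) (w : V) : casimir • a • w = a • casimir • w := smul_comm _ _ _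
  simp only [ι_smul, smul_add, comm, casimir_smul_basis]

/-- The span of `M` and its images under the products of basis elements of `G₋₁`; it is a submodule
if `M` is killed by `G₊₁`. -/
def kacSpan (M : Submodule ℂ V) : Submodule ℂ V :=
  M ⊔ M.map (actEnd V uy₁) ⊔ M.map (actEnd V uy₂) ⊔ M.map (actEnd V (uy₂ * uy₁))

theorem mem_kacSpan {M : Submodule ℂ V} {v : V} : v ∈ kacSpan M ↔
    ∃ m₀ ∈ M, ∃ m₁ ∈ M, ∃ m₂ ∈ M, ∃ m₃ ∈ M,
      v = m₀ + uy₁ • m₁ + uy₂ • m₂ + uy₂ • uy₁ • m₃ := by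
  simp only [kacSpan, Submodule.mem_sup, Submodule.mem_map, actEnd_apply, mul_smul]
  constructor
  · rintro ⟨_, ⟨_, ⟨m₀, h₀, _, ⟨m₁, h₁, rfl⟩, rfl⟩, _, ⟨m₂, h₂, rfl⟩, rfl⟩, _, ⟨m₃, h₃, rfl⟩, rfl⟩
    exact ⟨m₀, h₀, m₁, h₁, m₂, h₂, m₃, h₃, rfl⟩
  · rintro ⟨m₀, h₀, m₁, h₁, m₂, h₂, m₃, h₃, rfl⟩
    exact ⟨_, ⟨_, ⟨m₀, h₀, _, ⟨m₁, h₁, rfl⟩, rfl⟩, _, ⟨m₂, h₂, rfl⟩, rfl⟩, _, ⟨m₃, h₃, rfl⟩, rfl⟩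

theorem isEvenStable_kacSpan {M : Submodule ℂ V} (hM : IsEvenStable M) :
    IsEvenStable (kacSpan M) := by
  intro s hs
  obtain ⟨m₀, h₀, m₁, h₁, m₂, h₂, m₃, h₃, rfl⟩ := mem_kacSpan.1 hs
  obtain ⟨P₀, R₀, E₀, F₀⟩ := hM _ h₀
  obtain ⟨P₁, R₁, E₁, F₁⟩ := hM _ h₁
  obtain ⟨P₂, R₂, E₂, F₂⟩ := hM _ h₂
  obtain ⟨P₃, R₃, E₃, F₃⟩ := hM _ h₃
  simp only [mem_kacSpan]
  -- The witnesses are the coefficients left after moving each even element to the right past `y₁`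
  -- and `y₂`; the corrections come from the brackets, such as `[E, y₁] = -y₂`.
  refine ⟨⟨_, P₀, _, P₁, _, M.add_mem P₂ h₂, _, M.add_mem P₃ h₃, ?_⟩,
    ⟨_, R₀, _, M.add_mem R₁ h₁, _, R₂, _, M.add_mem R₃ h₃, ?_⟩,
    ⟨_, E₀, _, E₁, _, M.sub_mem E₂ h₁, _, E₃, ?_⟩,
    ⟨_, F₀, _, M.sub_mem F₁ h₂, _, F₂, _, F₃, ?_⟩⟩ <;>
    simp only [even_smul_y, y_smul_y, smul_add, smul_sub] <;>
    abel

theorem isOddStable_kacSpan {M : Submodule ℂ V} (hM : IsEvenStable M)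
    (hx : ∀ m ∈ M, ux₁ • m = 0 ∧ ux₂ • m = 0) : IsOddStable (kacSpan M) := by
  intro s hs
  obtain ⟨m₀, h₀, m₁, h₁, m₂, h₂, m₃, h₃, rfl⟩ := mem_kacSpan.1 hs
  obtain ⟨P₁, R₁, E₁, F₁⟩ := hM _ h₁
  obtain ⟨P₂, R₂, E₂, F₂⟩ := hM _ h₂
  obtain ⟨P₃, R₃, E₃, F₃⟩ := hM _ h₃
  have z := M.zero_mem
  simp only [mem_kacSpan]
  -- For example `x₁ y₂ y₁ m = y₁ E m - y₂ (P m + m)` when `x₁ m = 0`, which explains the sign and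
  -- the extra `m₃`.
  refine ⟨⟨_, M.add_mem P₁ E₂, _, E₃, _, M.neg_mem (M.add_mem P₃ h₃), _, z, ?_⟩,
    ⟨_, M.add_mem F₁ R₂, _, M.add_mem R₃ h₃, _, M.neg_mem F₃, _, z, ?_⟩,
    ⟨_, z, _, h₀, _, z, _, M.neg_mem h₂, ?_⟩, ⟨_, z, _, z, _, h₀, _, h₁, ?_⟩⟩ <;>
    simp only [even_smul_y, y_smul_y, x_smul_y, hx _ h₀, hx _ h₁, hx _ h₂, hx _ h₃, smul_add,
      smul_sub, smul_neg, smul_zero] <;>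
    abel

/-- The span of `M` and its images under `G₊₁`; it is a submodule if `M` is killed by `G₋₁` and by
the product of the basis elements of `G₊₁`. -/
def coKacSpan (M : Submodule ℂ V) : Submodule ℂ V :=
  M ⊔ M.map (actEnd V ux₁) ⊔ M.map (actEnd V ux₂)

theorem mem_coKacSpan {M : Submodule ℂ V} {v : V} : v ∈ coKacSpan M ↔
    ∃ m₀ ∈ M, ∃ m₁ ∈ M, ∃ m₂ ∈ M, v = m₀ + ux₁ • m₁ + ux₂ • m₂ := by
  simp only [coKacSpan, Submodule.mem_sup, Submodule.mem_map, actEnd_apply]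
  constructor
  · rintro ⟨_, ⟨m₀, h₀, _, ⟨m₁, h₁, rfl⟩, rfl⟩, _, ⟨m₂, h₂, rfl⟩, rfl⟩
    exact ⟨m₀, h₀, m₁, h₁, m₂, h₂, rfl⟩
  · rintro ⟨m₀, h₀, m₁, h₁, m₂, h₂, rfl⟩
    exact ⟨_, ⟨m₀, h₀, _, ⟨m₁, h₁, rfl⟩, rfl⟩, _, ⟨m₂, h₂, rfl⟩, rfl⟩

theorem isEvenStable_coKacSpan {M : Submodule ℂ V} (hM : IsEvenStable M) :
    IsEvenStable (coKacSpan M) := by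
  intro s hs
  obtain ⟨m₀, h₀, m₁, h₁, m₂, h₂, rfl⟩ := mem_coKacSpan.1 hs
  obtain ⟨P₀, R₀, E₀, F₀⟩ := hM _ h₀
  obtain ⟨P₁, R₁, E₁, F₁⟩ := hM _ h₁
  obtain ⟨P₂, R₂, E₂, F₂⟩ := hM _ h₂
  simp only [mem_coKacSpan]
  refine ⟨⟨_, P₀, _, P₁, _, M.sub_mem P₂ h₂, ?_⟩, ⟨_, R₀, _, M.sub_mem R₁ h₁, _, R₂, ?_⟩,
    ⟨_, E₀, _, M.add_mem E₁ h₂, _, E₂, ?_⟩, ⟨_, F₀, _, F₁, _, M.add_mem F₂ h₁, ?_⟩⟩ <;>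
    simp only [even_smul_x, smul_add, smul_sub] <;>
    abel

/-- For `m` in `M`, `y x m` reduces to the action on `m` of an element of `G₀`, since `y m = 0`. The
only new vectors that `G₊₁` could create are multiples of `x₁ x₂ m`, and these vanish. -/
theorem isOddStable_coKacSpan {M : Submodule ℂ V} (hM : IsEvenStable M)
    (hy : ∀ m ∈ M, uy₁ • m = 0 ∧ uy₂ • m = 0) (hx : ∀ m ∈ M, ux₁ • ux₂ • m = 0) :
    IsOddStable (coKacSpan M) := by
  intro s hs
  obtain ⟨m₀, h₀, m₁, h₁, m₂, h₂, rfl⟩ := mem_coKacSpan.1 hs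
  obtain ⟨P₁, R₁, E₁, F₁⟩ := hM _ h₁
  obtain ⟨P₂, R₂, E₂, F₂⟩ := hM _ h₂
  have z := M.zero_mem
  simp only [mem_coKacSpan]
  refine ⟨⟨_, z, _, h₀, _, z, ?_⟩, ⟨_, z, _, z, _, h₀, ?_⟩,
    ⟨_, M.add_mem P₁ F₂, _, z, _, z, ?_⟩, ⟨_, M.add_mem E₁ R₂, _, z, _, z, ?_⟩⟩ <;>
    simp only [x_smul_x, y_smul_x, hx _ h₁, hx _ h₂, hy _ h₀, hy _ h₁, hy _ h₂, smul_add,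
      smul_zero, neg_zero] <;>
    abel

end Stable

/-! ### An explicit model of the induced module. -/

section Kac

variable {W : Type*} [AddCommGroup W] [Module ℂ W]

/-- The action of `E₁₁ + E₃₃` on `W ⊕ y₁ W ⊕ y₂ W ⊕ y₂ y₁ W`. -/
def kacP (p : Module.End ℂ W) : Module.End ℂ (W × W × W × W) where
  toFun m := (p m.1, p m.2.1, p m.2.2.1 + m.2.2.1, p m.2.2.2 + m.2.2.2)
  map_add' a b := by ext <;> simp <;> abel
  map_smul' a b := by ext <;> simp

/-- The action of `E₂₂ + E₃₃` on `W ⊕ y₁ W ⊕ y₂ W ⊕ y₂ y₁ W`. -/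
def kacR (r : Module.End ℂ W) : Module.End ℂ (W × W × W × W) where
  toFun m := (r m.1, r m.2.1 + m.2.1, r m.2.2.1, r m.2.2.2 + m.2.2.2)
  map_add' a b := by ext <;> simp <;> abel
  map_smul' a b := by ext <;> simp

/-- The action of `E₁₂` on `W ⊕ y₁ W ⊕ y₂ W ⊕ y₂ y₁ W`. -/
def kacE (e : Module.End ℂ W) : Module.End ℂ (W × W × W × W) where
  toFun m := (e m.1, e m.2.1, e m.2.2.1 - m.2.1, e m.2.2.2)
  map_add' a b := by ext <;> simp <;> abel
  map_smul' a b := by ext <;> simp [smul_sub]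

/-- The action of `E₂₁` on `W ⊕ y₁ W ⊕ y₂ W ⊕ y₂ y₁ W`. -/
def kacF (f : Module.End ℂ W) : Module.End ℂ (W × W × W × W) where
  toFun m := (f m.1, f m.2.1 - m.2.2.1, f m.2.2.1, f m.2.2.2)
  map_add' a b := by ext <;> simp <;> abel
  map_smul' a b := by ext <;> simp [smul_sub]

/-- The action of `E₁₃` on `W ⊕ y₁ W ⊕ y₂ W ⊕ y₂ y₁ W`. -/
def kacx₁ (p e : Module.End ℂ W) : Module.End ℂ (W × W × W × W) where
  toFun m := (p m.2.1 + e m.2.2.1, e m.2.2.2, -(p m.2.2.2 + m.2.2.2), 0)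
  map_add' a b := by ext <;> simp <;> abel
  map_smul' a b := by ext <;> simp

/-- The action of `E₂₃` on `W ⊕ y₁ W ⊕ y₂ W ⊕ y₂ y₁ W`. -/
def kacx₂ (r f : Module.End ℂ W) : Module.End ℂ (W × W × W × W) where
  toFun m := (f m.2.1 + r m.2.2.1, r m.2.2.2 + m.2.2.2, -f m.2.2.2, 0)
  map_add' a b := by ext <;> simp <;> abel
  map_smul' a b := by ext <;> simp

/-- The action of `E₃₁` on `W ⊕ y₁ W ⊕ y₂ W ⊕ y₂ y₁ W`. -/
def kacy₁ : Module.End ℂ (W × W × W × W) where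
  toFun m := (0, m.1, 0, -m.2.2.1)
  map_add' a b := by ext <;> simp; abel
  map_smul' a b := by ext <;> simp

/-- The action of `E₃₂` on `W ⊕ y₁ W ⊕ y₂ W ⊕ y₂ y₁ W`. -/
def kacy₂ : Module.End ℂ (W × W × W × W) where
  toFun m := (0, 0, m.1, m.2.1)
  map_add' a b := by ext <;> simp
  map_smul' a b := by ext <;> simp

/-- The operators are the formulas found by moving each basis element past the `y`'s onto `W`, with
`G₊₁` killing `W`. Their relations reduce, coordinate by coordinate, to those of `gl(2)` on `W`.
This model replaces the PBW theorem. -/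
theorem kac_relations {p r e f : Module.End ℂ W} (hpr : ∀ w, p (r w) = r (p w))
    (hpe : ∀ w, p (e w) = e (p w) + e w) (hre : ∀ w, r (e w) = e (r w) - e w)
    (hpf : ∀ w, p (f w) = f (p w) - f w) (hrf : ∀ w, r (f w) = f (r w) + f w)
    (hef : ∀ w, e (f w) = f (e w) + p w - r w) :
    Relations (kacP p) (kacR r) (kacE e) (kacF f) (kacx₁ p e) (kacx₂ r f) kacy₁ kacy₂ := by
  constructor <;>
    refine LinearMap.ext fun ⟨a, b, c, d⟩ => ?_ <;>
    simp only [kacP, kacR, kacE, kacF, kacx₁, kacx₂, kacy₁, kacy₂, Module.End.mul_apply,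
      LinearMap.add_apply, LinearMap.sub_apply, LinearMap.neg_apply, LinearMap.zero_apply,
      LinearMap.coe_mk, AddHom.coe_mk, Prod.mk_add_mk, Prod.mk_sub_mk, Prod.neg_mk, map_add,
      map_sub, map_neg, map_zero, hpr, hpe, hre, hpf, hrf, hef] <;>
    refine Prod.ext ?_ (Prod.ext ?_ (Prod.ext ?_ ?_)) <;>
    simp only [Prod.fst_zero, Prod.snd_zero] <;>
    abel

end Kac

section KacSpace

variable (W : Type*)

/-- The Kac module of `W`. -/
def Kac : Type _ := W × W × W × W

instance [AddCommGroup W] : AddCommGroup (Kac W) := inferInstanceAs (AddCommGroup (W × W × W × W))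

instance [AddCommGroup W] [Module ℂ W] : Module ℂ (Kac W) := inferInstanceAs (Module ℂ (W × W × W × W))

variable {W}

/-- The vector `m₀ + y₁ m₁ + y₂ m₂ + y₂ y₁ m₃` of the Kac module. -/
def Kac.mk (m₀ m₁ m₂ m₃ : W) : Kac W := (m₀, m₁, m₂, m₃)

theorem Kac.mk_inj {a b c d a' b' c' d' : W} :
    Kac.mk a b c d = Kac.mk a' b' c' d' ↔ a = a' ∧ b = b' ∧ c = c' ∧ d = d' := by
  change ((a, b, c, d) : W × W × W × W) = (a', b', c', d') ↔ _
  simp only [Prod.mk.injEq]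

variable [AddCommGroup W] [Module ℂ W]

/-- The embedding of `W` into its Kac module. -/
def Kac.of : W →ₗ[ℂ] Kac W where
  toFun w := Kac.mk w 0 0 0
  map_add' a b := by
    change _ = ((a + b, 0 + 0, 0 + 0, 0 + 0) : W × W × W × W)
    simp only [add_zero]
    rfl
  map_smul' a b := by
    change _ = ((a • b, a • 0, a • 0, a • 0) : W × W × W × W)
    simp only [smul_zero]
    rfl

theorem Kac.of_apply (w : W) : Kac.of w = Kac.mk w 0 0 0 := rfl

end KacSpace

section GZero

variable {W : Type*} [AddCommGroup W] [LieRingModule G0 W]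

theorem lie_even_even (a b c d a' b' c' d' : ℂ) :
    ⁅even a b c d, even a' b' c' d'⁆ =
      even (b * c' - b' * c) (a * b' + b * d' - a' * b - b' * d)
        (c * a' + d * c' - c' * a - d' * c) (c * b' - c' * b) := by
  apply Subtype.ext
  change _ * _ - _ * _ = _
  ext i j
  fin_cases i <;> fin_cases j <;> simp [even] <;> ring

theorem lie_even_lie_even (a b c d a' b' c' d' : ℂ) (w : W) :
    ⁅even a b c d, ⁅even a' b' c' d', w⁆⁆ = ⁅even a' b' c' d', ⁅even a b c d, w⁆⁆ +
      ⁅even (b * c' - b' * c) (a * b' + b * d' - a' * b - b' * d)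
        (c * a' + d * c' - c' * a - d' * c) (c * b' - c' * b), w⁆ := by
  rw [leibniz_lie, lie_even_even, add_comm]

variable [Module ℂ W] [LieModule ℂ G0 W]

theorem even_eq (a b c d : ℂ) :
    even a b c d = a • even 1 0 0 0 + b • even 0 1 0 0 + c • even 0 0 1 0 + d • even 0 0 0 1 := by
  apply Subtype.ext
  ext i j
  fin_cases i <;> fin_cases j <;> simp [even]

theorem eq_even (g : G0) : g = even (g.1 0 0) (g.1 0 1) (g.1 1 0) (g.1 1 1) := by
  have h := isHomogeneous_zero_iff.1 g.2.2
  have h' := G_apply_two_two (G0.toG g)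
  apply Subtype.ext
  ext i j
  fin_cases i <;> fin_cases j <;> simp [even, h]
  exact h'

theorem lie_even (a b c d : ℂ) (w : W) :
    ⁅even a b c d, w⁆ = a • ⁅even 1 0 0 0, w⁆ + b • ⁅even 0 1 0 0, w⁆ + c • ⁅even 0 0 1 0, w⁆ +
      d • ⁅even 0 0 0 1, w⁆ := by
  rw [even_eq a]
  simp only [add_lie, smul_lie]

variable (W)

theorem kac_relations_lie : Relations (A := Module.End ℂ (W × W × W × W))
    (kacP (LieModule.toEnd ℂ G0 W (even 1 0 0 0))) (kacR (LieModule.toEnd ℂ G0 W (even 0 0 0 1)))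
    (kacE (LieModule.toEnd ℂ G0 W (even 0 1 0 0))) (kacF (LieModule.toEnd ℂ G0 W (even 0 0 1 0)))
    (kacx₁ (LieModule.toEnd ℂ G0 W (even 1 0 0 0)) (LieModule.toEnd ℂ G0 W (even 0 1 0 0)))
    (kacx₂ (LieModule.toEnd ℂ G0 W (even 0 0 0 1)) (LieModule.toEnd ℂ G0 W (even 0 0 1 0)))
    kacy₁ kacy₂ := by
  apply kac_relations <;> intro w <;>
  · simp only [LieModule.toEnd_apply_apply]
    rw [lie_even_lie_even, lie_even (W := W) (_ - _)]
    simp [sub_eq_add_neg, add_assoc]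

/-- The action of `U(G)` on the Kac module. -/
def Kac.action : U →ₐ[ℂ] Module.End ℂ (Kac W) := (kac_relations_lie W).lift

instance : Module U (Kac W) := Module.compHom (Kac W) (Kac.action W).toRingHom

instance : IsScalarTower ℂ U (Kac W) where
  smul_assoc a u v := by
    change Kac.action W (a • u) v = a • Kac.action W u v
    rw [map_smul]
    rfl

variable {W}

theorem Kac.ι_even_smul (a b c d : ℂ) (m : Kac W) : ι (G0.toG (even a b c d)) • m =
    a • kacP (LieModule.toEnd ℂ G0 W (even 1 0 0 0)) m +
    b • kacE (LieModule.toEnd ℂ G0 W (even 0 1 0 0)) m +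
    c • kacF (LieModule.toEnd ℂ G0 W (even 0 0 1 0)) m +
    d • kacR (LieModule.toEnd ℂ G0 W (even 0 0 0 1)) m := by
  change (kac_relations_lie W).lift _ _ = _
  rw [Relations.lift_ι, linearLift_even]
  rfl

theorem Kac.ι_odd_smul (a b c d : ℂ) (m : Kac W) : ι (odd a b c d) • m =
    a • kacx₁ (LieModule.toEnd ℂ G0 W (even 1 0 0 0)) (LieModule.toEnd ℂ G0 W (even 0 1 0 0)) m +
    b • kacx₂ (LieModule.toEnd ℂ G0 W (even 0 0 0 1)) (LieModule.toEnd ℂ G0 W (even 0 0 1 0)) m +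
    c • kacy₁ (W := W) m + d • kacy₂ (W := W) m := by
  change (kac_relations_lie W).lift _ _ = _
  rw [Relations.lift_ι, linearLift_odd]
  rfl

theorem Kac.smul_mk (m₀ m₁ m₂ m₃ : W) :
    ux₁ • Kac.mk m₀ m₁ m₂ m₃ = Kac.mk (⁅even 1 0 0 0, m₁⁆ + ⁅even 0 1 0 0, m₂⁆)
      ⁅even 0 1 0 0, m₃⁆ (-(⁅even 1 0 0 0, m₃⁆ + m₃)) 0 ∧
    ux₂ • Kac.mk m₀ m₁ m₂ m₃ = Kac.mk (⁅even 0 0 1 0, m₁⁆ + ⁅even 0 0 0 1, m₂⁆)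
      (⁅even 0 0 0 1, m₃⁆ + m₃) (-⁅even 0 0 1 0, m₃⁆) 0 ∧
    uy₁ • Kac.mk m₀ m₁ m₂ m₃ = Kac.mk 0 m₀ 0 (-m₂) ∧
    uy₂ • Kac.mk m₀ m₁ m₂ m₃ = Kac.mk 0 0 m₀ m₁ := by
  simp only [ux₁, ux₂, uy₁, uy₂, Kac.ι_odd_smul, one_smul, zero_smul, add_zero, zero_add]
  exact ⟨rfl, rfl, rfl, rfl⟩

theorem Kac.even_smul_of (w : W) :
    uP • Kac.of w = Kac.of ⁅even 1 0 0 0, w⁆ ∧ uR • Kac.of w = Kac.of ⁅even 0 0 0 1, w⁆ ∧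
    uE • Kac.of w = Kac.of ⁅even 0 1 0 0, w⁆ ∧ uF • Kac.of w = Kac.of ⁅even 0 0 1 0, w⁆ := by
  have h (t : Module.End ℂ W) (w : W) : kacP t (w, 0, 0, 0) = (t w, 0, 0, 0) ∧
      kacR t (w, 0, 0, 0) = (t w, 0, 0, 0) ∧ kacE t (w, 0, 0, 0) = (t w, 0, 0, 0) ∧
      kacF t (w, 0, 0, 0) = (t w, 0, 0, 0) := by
    simp [kacP, kacR, kacE, kacF]
  simp only [uP, uR, uE, uF, Kac.ι_even_smul, one_smul, zero_smul, add_zero, zero_add]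
  exact ⟨(h _ w).1, (h _ w).2.1, (h _ w).2.2.1, (h _ w).2.2.2⟩

theorem Kac.of_lie (g : G0) (w : W) : Kac.of ⁅g, w⁆ = ι (G0.toG g) • Kac.of w := by
  conv_lhs => rw [eq_even g, lie_even]
  simp only [ι_toG_smul, map_add, map_smul, Kac.even_smul_of]

theorem Gplus_eq_odd (y : Gplus) : y.1 = odd (y.1.1 0 2) (y.1.1 1 2) 0 0 := by
  apply Subtype.ext
  ext i j
  have h := y.2
  fin_cases i <;> fin_cases j <;> simp [odd] <;> exact h _ _ (by simp)

end GZero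

/-! ### Universal property of the induced module and comparison with the model. -/

section Universal

variable {W : Type*} [AddCommGroup W] [Module ℂ W] [LieRingModule G0 W]
variable {V : Type*} [AddCommGroup V] [Module ℂ V] [Module U V] [IsScalarTower ℂ U V]

/-- The universal property of the induced module. -/
theorem Induced.exists_lift (f : W →ₗ[ℂ] V) (hf : ∀ (g : G0) w, f ⁅g, w⁆ = ι (G0.toG g) • f w)
    (hx : ∀ w, ux₁ • f w = 0 ∧ ux₂ • f w = 0) :
    ∃ F : Induced W →ₗ[U] V, ∀ w, F (Induced.of W w) = f w := by
  let F' : U ⊗[ℂ] W →ₗ[U] V := TensorProduct.AlgebraTensorModule.lift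
    { toFun := fun u => actEnd V u ∘ₗ f
      map_add' := fun u v => by ext; simp [add_smul]
      map_smul' := fun u v => by ext; simp [mul_smul] }
  have hF' (u : U) (w : W) : F' (u ⊗ₜ w) = u • f w := rfl
  refine ⟨(inducedRelations W).liftQ F' (Submodule.span_le.2 ?_), fun w => ?_⟩
  · rintro _ (⟨g, w, rfl⟩ | ⟨y, w, rfl⟩)
    · rw [SetLike.mem_coe, LinearMap.mem_ker, map_sub, hF', hF', hf, one_smul, sub_self]
    · rw [SetLike.mem_coe, LinearMap.mem_ker, hF', Gplus_eq_odd, ι_odd]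
      simp only [add_smul, smul_assoc, hx, zero_smul, smul_zero, add_zero]
  · exact (Submodule.liftQ_apply ..).trans ((hF' 1 w).trans (one_smul U _))

theorem Induced.of_lie (g : G0) (w : W) :
    Induced.of W ⁅g, w⁆ = ι (G0.toG g) • Induced.of W w := by
  refine Eq.symm ((Submodule.Quotient.eq _).2 (Submodule.subset_span (Or.inl ⟨g, w, ?_⟩)))
  beta_reduce
  rw [TensorProduct.smul_tmul', smul_eq_mul, mul_one]

theorem Induced.x_smul_of (w : W) :
    ux₁ • Induced.of W w = 0 ∧ ux₂ • Induced.of W w = 0 := by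
  have key (y : Gplus) : ι y.1 • Induced.of W w = 0 := by
    refine (Submodule.Quotient.mk_eq_zero _).2 (Submodule.subset_span (Or.inr ⟨y, w, ?_⟩))
    beta_reduce
    rw [TensorProduct.smul_tmul', smul_eq_mul, mul_one]
  constructor
  · exact key ⟨odd 1 0 0 0, fun i j h => by fin_cases i <;> fin_cases j <;> simp_all [odd]⟩
  · exact key ⟨odd 0 1 0 0, fun i j h => by fin_cases i <;> fin_cases j <;> simp_all [odd]⟩

theorem Induced.isEvenStable_range : IsEvenStable (LinearMap.range (Induced.of W)) := by
  rw [isEvenStable_iff]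
  rintro g _ ⟨w, rfl⟩
  exact ⟨⁅g, w⁆, Induced.of_lie g w⟩

/-- The right-hand sides form a `G`-submodule, because `G₊₁` kills `W`, and it contains the
generators `1 ⊗ w`. -/
theorem Induced.eq_sum (v : Induced W) : ∃ w₀ w₁ w₂ w₃ : W, v = Induced.of W w₀ +
    uy₁ • Induced.of W w₁ + uy₂ • Induced.of W w₂ + uy₂ • uy₁ • Induced.of W w₃ := by
  have hx : ∀ m ∈ LinearMap.range (Induced.of W), ux₁ • m = 0 ∧ ux₂ • m = 0 := by
    rintro _ ⟨w, rfl⟩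
    exact Induced.x_smul_of w
  let S := toSubmodule (kacSpan (LinearMap.range (Induced.of W)))
    (isEvenStable_kacSpan Induced.isEvenStable_range)
    (isOddStable_kacSpan Induced.isEvenStable_range hx)
  have hS (w : W) : Induced.of W w ∈ S :=
    mem_kacSpan.2 ⟨_, ⟨w, rfl⟩, 0, zero_mem _, 0, zero_mem _, 0, zero_mem _, by simp⟩
  have hv : v ∈ S := by
    obtain ⟨t, rfl⟩ := (inducedRelations W).mkQ_surjective v
    induction t using TensorProduct.induction_on with
    | zero =>
      rw [map_zero]
      exact S.zero_mem
    | tmul u w =>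
      have h : (inducedRelations W).mkQ (u ⊗ₜ w) = u • Induced.of W w := by
        refine Eq.trans ?_ ((inducedRelations W).mkQ.map_smul u (1 ⊗ₜ w))
        simp [TensorProduct.smul_tmul']
      rw [h]
      exact S.smul_mem u (hS w)
    | add a b ha hb =>
      rw [map_add]
      exact S.add_mem ha hb
  obtain ⟨_, ⟨w₀, rfl⟩, _, ⟨w₁, rfl⟩, _, ⟨w₂, rfl⟩, _, ⟨w₃, rfl⟩, h⟩ := mem_kacSpan.1 hv
  exact ⟨w₀, w₁, w₂, w₃, h⟩

/-- The comparison of the induced module with the Kac module. -/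
theorem Induced.exists_toKac (W : Type*) [AddCommGroup W] [Module ℂ W] [LieRingModule G0 W]
    [LieModule ℂ G0 W] : ∃ F : Induced W →ₗ[U] Kac W, ∀ w, F (Induced.of W w) = Kac.of w :=
  Induced.exists_lift Kac.of Kac.of_lie fun w => by
    simp only [Kac.of_apply, Kac.smul_mk, lie_zero, add_zero, neg_zero]
    exact ⟨rfl, rfl⟩

end Universal

/-! ### Commuting operators on indecomposable modules. -/

section Indecomposable

variable {V : Type*} [AddCommGroup V] [Module ℂ V] [Module U V] [IsScalarTower ℂ U V]

theorem IsIndecomposable.eq_bot_or_eq_bot (hV : IsIndecomposable V) (A B : Submodule ℂ V)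
    (hA : ∀ g, ∀ a ∈ A, ι g • a ∈ A) (hB : ∀ g, ∀ b ∈ B, ι g • b ∈ B) (h : IsCompl A B) :
    A = ⊥ ∨ B = ⊥ := by
  let A' : Submodule U V := { A with smul_mem' := fun u a ha => smul_mem_of_ι_smul_mem hA u a ha }
  let B' : Submodule U V := { B with smul_mem' := fun u b hb => smul_mem_of_ι_smul_mem hB u b hb }
  have h' : IsCompl A' B' := by
    refine ⟨Submodule.disjoint_def.2 fun x => Submodule.disjoint_def.1 h.disjoint x, ?_⟩
    refine Submodule.codisjoint_iff_exists_add_eq.2 fun z => ?_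
    exact Submodule.codisjoint_iff_exists_add_eq.1 h.codisjoint z
  refine (hV.2 A' B' h').imp (fun h => ?_) (fun h => ?_)
  · exact (Submodule.eq_bot_iff _).2 fun x hx => (Submodule.eq_bot_iff _).1 h x hx
  · exact (Submodule.eq_bot_iff _).2 fun x hx => (Submodule.eq_bot_iff _).1 h x hx

theorem IsIndecomposable.exists_maxGenEigenspace_eq_top (hV : IsIndecomposable V)
    {T : Module.End ℂ V} (hT : IsLocallyFinite T) (hc : ∀ g v, T (ι g • v) = ι g • T v) :
    ∃ μ, T.maxGenEigenspace μ = ⊤ := by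
  have := hV.1
  refine hT.exists_maxGenEigenspace_eq_top (Set.range fun g => actEnd V (ι g)) ?_ ?_
  · rintro _ ⟨g, rfl⟩
    exact LinearMap.ext fun v => hc g v
  · intro A B hA hB
    exact hV.eq_bot_or_eq_bot A B (fun g => hA _ ⟨g, rfl⟩) (fun g => hB _ ⟨g, rfl⟩)

theorem IsIndecomposableG0.exists_maxGenEigenspace_eq_top {W : Type*} [AddCommGroup W]
    [Module ℂ W] [LieRingModule G0 W] [LieModule ℂ G0 W] (hW : IsIndecomposableG0 W)
    {T : Module.End ℂ W} (hT : IsLocallyFinite T) (hc : ∀ (g : G0) w, T ⁅g, w⁆ = ⁅g, T w⁆) :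
    ∃ μ, T.maxGenEigenspace μ = ⊤ := by
  have := hW.1
  refine hT.exists_maxGenEigenspace_eq_top (Set.range fun g => LieModule.toEnd ℂ G0 W g) ?_ ?_
  · rintro _ ⟨g, rfl⟩
    exact LinearMap.ext fun v => hc g v
  · intro A B hA hB h
    let A' : LieSubmodule ℂ G0 W := { A with lie_mem := fun {g} a ha => hA _ ⟨g, rfl⟩ a ha }
    let B' : LieSubmodule ℂ G0 W := { B with lie_mem := fun {g} b hb => hB _ ⟨g, rfl⟩ b hb }
    have h' : IsCompl A' B' := LieSubmodule.isCompl_toSubmodule.1 h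
    refine (hW.2 A' B' h').imp (fun h => ?_) (fun h => ?_)
    · exact congrArg LieSubmodule.toSubmodule h
    · exact congrArg LieSubmodule.toSubmodule h

end Indecomposable

/-! ### Typicality and the Casimir element. -/

section Typical

variable {W : Type*} [AddCommGroup W] [Module ℂ W] [LieRingModule G0 W] [LieModule ℂ G0 W]

/-- In the Kac module, `w` is the last coordinate of `y₂ y₁ w`. -/
theorem Induced.eq_zero_of_y_smul_of {w : W} (h : uy₂ • uy₁ • Induced.of W w = 0) : w = 0 := by
  obtain ⟨F, hF⟩ := Induced.exists_toKac W
  have h' := congrArg F h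
  rw [F.map_smul, F.map_smul, hF, map_zero, Kac.of_apply] at h'
  simp only [Kac.smul_mk] at h'
  exact (Kac.mk_inj.1 h').2.2.2

theorem Induced.of_injective : Function.Injective (Induced.of W) := by
  refine (injective_iff_map_eq_zero _).2 fun w h => Induced.eq_zero_of_y_smul_of ?_
  rw [h, smul_zero, smul_zero]

theorem x_smul_y_smul_eq_casimir_smul {V : Type*} [AddCommGroup V] [Module U V] {v : V}
    (h₁ : ux₁ • v = 0) (h₂ : ux₂ • v = 0) : ux₁ • ux₂ • uy₂ • uy₁ • v = casimir • v := by
  rw [casimir_smul_eq]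
  simp only [h₁, h₂, smul_zero, add_zero, sub_zero]

/-- On `W` the terms of `C` ending in `x₁` or `x₂` vanish, and the rest lies in `U(G₀)`. -/
theorem Induced.casimir_smul_mem {v : Induced W} (hv : v ∈ LinearMap.range (Induced.of W)) :
    casimir • v ∈ LinearMap.range (Induced.of W) := by
  obtain ⟨w, rfl⟩ := hv
  have hs := Induced.isEvenStable_range (W := W)
  have h := hs _ ⟨w, rfl⟩
  rw [casimir_smul, (Induced.x_smul_of w).1, (Induced.x_smul_of w).2, smul_zero, smul_zero,
    sub_zero, sub_zero]
  exact sub_mem (add_mem (hs _ h.2.1).1 h.1) (hs _ h.2.2.2).2.2.1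

/-- On a typical induced module, the Casimir element kills no nonzero element of `W`. -/
theorem IsTypical.eq_zero_of_casimir_smul (htyp : IsTypical W) (w : W)
    (hw : casimir • Induced.of W w = 0) : w = 0 := by
  obtain ⟨F, hF⟩ := Induced.exists_toKac W
  -- `M` is the image under `y₂ y₁` of the kernel of `C` on `W`. It is killed by `G₋₁`, and by `x₁
  -- x₂` because `x₁ x₂ y₂ y₁ w = C w = 0`; so `coKacSpan M` is a submodule.
  let M : Submodule ℂ (Induced W) :=
    ((LinearMap.range (Induced.of W)) ⊓ LinearMap.ker (actEnd (Induced W) casimir)).map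
      (actEnd (Induced W) (uy₂ * uy₁))
  have mem_M {v : Induced W} : v ∈ M ↔
      ∃ w, casimir • Induced.of W w = 0 ∧ uy₂ • uy₁ • Induced.of W w = v := by
    constructor
    · rintro ⟨_, ⟨⟨w, rfl⟩, h⟩, rfl⟩
      exact ⟨w, h, (mul_smul ..).symm⟩
    · rintro ⟨w, h, rfl⟩
      exact ⟨_, ⟨⟨w, rfl⟩, h⟩, mul_smul ..⟩
  have hM : IsEvenStable M := by
    intro v hv
    obtain ⟨w, h, rfl⟩ := mem_M.1 hv
    have hl (g : G0) : casimir • Induced.of W ⁅g, w⁆ = 0 := by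
      rw [Induced.of_lie, casimir_smul_ι_smul, h, smul_zero]
    -- The product `y₂ y₁` has weight one for both `P` and `R`, which accounts for the added `w`.
    refine ⟨mem_M.2 ⟨⁅even 1 0 0 0, w⁆ + w, ?_⟩, mem_M.2 ⟨⁅even 0 0 0 1, w⁆ + w, ?_⟩,
      mem_M.2 ⟨⁅even 0 1 0 0, w⁆, hl _, ?_⟩, mem_M.2 ⟨⁅even 0 0 1 0, w⁆, hl _, ?_⟩⟩
    · rw [map_add, smul_add, hl, h, Induced.of_lie]
      change _ ∧ uy₂ • uy₁ • (uP • _ + _) = _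
      simp only [even_smul_y, smul_add, add_zero, true_and]
    · rw [map_add, smul_add, hl, h, Induced.of_lie]
      change _ ∧ uy₂ • uy₁ • (uR • _ + _) = _
      simp only [even_smul_y, smul_add, add_zero, true_and]
    · rw [Induced.of_lie]
      change uy₂ • uy₁ • uE • _ = _
      simp only [even_smul_y, y_smul_y, smul_sub, sub_zero]
    · rw [Induced.of_lie]
      change uy₂ • uy₁ • uF • _ = _
      simp only [even_smul_y, y_smul_y, sub_zero]
  have hy : ∀ m ∈ M, uy₁ • m = 0 ∧ uy₂ • m = 0 := by
    intro v hv
    obtain ⟨w, h, rfl⟩ := mem_M.1 hv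
    simp only [y_smul_y, smul_zero, neg_zero, and_self]
  have hx : ∀ m ∈ M, ux₁ • ux₂ • m = 0 := by
    intro v hv
    obtain ⟨w, h, rfl⟩ := mem_M.1 hv
    rw [x_smul_y_smul_eq_casimir_smul (Induced.x_smul_of w).1 (Induced.x_smul_of w).2, h]
  let N := toSubmodule (coKacSpan M) (isEvenStable_coKacSpan hM) (isOddStable_coKacSpan hM hy hx)
  have hN : N = ⊥ := by
    refine htyp N ((Submodule.eq_bot_iff _).2 ?_)
    rintro v ⟨hv, w, rfl⟩
    obtain ⟨m₀, h₀, m₁, h₁, m₂, h₂, h⟩ := mem_coKacSpan.1 hv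
    obtain ⟨w₀, -, rfl⟩ := mem_M.1 h₀
    obtain ⟨w₁, -, rfl⟩ := mem_M.1 h₁
    obtain ⟨w₂, -, rfl⟩ := mem_M.1 h₂
    have h' := congrArg F h
    simp only [map_add, F.map_smul, hF, Kac.of_apply, Kac.smul_mk] at h'
    -- Elements of `coKacSpan M` have no component in `W`: a single `x` applied to `y₂ y₁ w` still
    -- leaves one `y`.
    have h'' : w = 0 := by
      have := congrArg (fun v : W × W × W × W => v.1) h'
      refine this.trans ?_
      change 0 + (_ + _) + (_ + _) = (0 : W)
      simp only [lie_zero, add_zero]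
    rw [h'', map_zero]
  refine Induced.eq_zero_of_y_smul_of ((Submodule.eq_bot_iff N).1 hN _ ?_)
  exact mem_coKacSpan.2 ⟨_, mem_M.2 ⟨w, hw, rfl⟩, 0, zero_mem _, 0, zero_mem _, by simp⟩

/-- If `C` had a kernel, its only generalized eigenvalue on `V` would be `0`, so it would be locally
nilpotent. But it maps `W ≠ 0` injectively into itself. -/
theorem IsTypical.casimir_bijective {V : Type*} [AddCommGroup V] [Module ℂ V] [Module U V]
    [IsScalarTower ℂ U V] (hweight : IsWeightModule V) (hV : IsIndecomposable V) [Nontrivial W]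
    (htyp : IsTypical W) (φ : Induced W →ₗ[U] V) (hφ : Function.Injective φ) :
    Function.Bijective (actEnd V casimir) := by
  have hlf : IsLocallyFinite (actEnd V casimir) :=
    hweight.isLocallyFinite fun h v => casimir_smul_ι_smul h.1 v
  suffices h : Function.Injective (actEnd V casimir) from ⟨h, hlf.surjective h⟩
  obtain ⟨μ, hμ⟩ := hV.exists_maxGenEigenspace_eq_top hlf casimir_smul_ι_smul
  refine (injective_iff_map_eq_zero _).2 fun v hv => ?_
  by_contra hv0
  have hv' : v ∈ (actEnd V casimir).maxGenEigenspace 0 :=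
    (Module.End.mem_maxGenEigenspace ..).2 ⟨1, by simpa using hv⟩
  have h0 : μ = 0 := by
    by_contra hne
    have hd := (Module.End.disjoint_genEigenspace (actEnd V casimir) hne ⊤ ⊤)
    refine hv0 (Submodule.disjoint_def.1 hd v ?_ hv')
    change v ∈ (actEnd V casimir).maxGenEigenspace μ
    rw [hμ]
    trivial
  have key : ∀ (k : ℕ) (w : W), ((actEnd V casimir) ^ k) (φ (Induced.of W w)) = 0 → w = 0 := by
    intro k
    induction k with
    | zero =>
      intro w h
      exact Induced.of_injective ((hφ (h.trans (map_zero φ).symm)).trans (map_zero _).symm)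
    | succ k ih =>
      intro w h
      obtain ⟨w', hw'⟩ := Induced.casimir_smul_mem (LinearMap.mem_range_self (Induced.of W) w)
      rw [pow_succ, Module.End.mul_apply, actEnd_apply, ← map_smul, ← hw'] at h
      refine htyp.eq_zero_of_casimir_smul w ?_
      rw [← hw', ih w' h, map_zero]
  obtain ⟨w, hw⟩ := exists_ne (0 : W)
  have hw' : φ (Induced.of W w) ∈ (actEnd V casimir).maxGenEigenspace μ := by
    rw [hμ]
    trivial
  obtain ⟨k, hk⟩ := (Module.End.mem_maxGenEigenspace ..).1 hw'
  rw [h0, zero_smul, sub_zero] at hk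
  exact hw (key k w hk)

end Typical

/-! ### The `G₊₁`-invariants when the Casimir element is invertible. -/

section Invariants

variable (V : Type*) [AddCommGroup V] [Module ℂ V] [Module U V] [IsScalarTower ℂ U V]

/-- The vectors which are killed by `G₊₁`. -/
def invariants : LieSubmodule ℂ G0 V where
  __ := LinearMap.ker (actEnd V ux₁) ⊓ LinearMap.ker (actEnd V ux₂)
  lie_mem := by
    intro g m hm
    refine (isEvenStable_iff (S := LinearMap.ker (actEnd V ux₁) ⊓ LinearMap.ker (actEnd V ux₂))).1
      ?_ g m hm
    rintro v ⟨h₁, h₂⟩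
    have h₁ : ux₁ • v = 0 := h₁
    have h₂ : ux₂ • v = 0 := h₂
    have e := even_smul_x (V := V)
    simp only [Submodule.mem_inf, LinearMap.mem_ker, actEnd_apply]
    refine ⟨⟨?_, ?_⟩, ⟨?_, ?_⟩, ⟨?_, ?_⟩, ⟨?_, ?_⟩⟩
    · rw [← e.1, h₁, smul_zero]
    · simpa [h₂] using (e.2.1 v).symm
    · simpa [h₁] using (e.2.2.1 v).symm
    · rw [← e.2.2.2.1, h₂, smul_zero]
    · rw [← e.2.2.2.2.1, h₁, smul_zero]
    · simpa [h₁, h₂] using (e.2.2.2.2.2.1 v).symm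
    · simpa [h₁, h₂] using (e.2.2.2.2.2.2.1 v).symm
    · rw [← e.2.2.2.2.2.2.2, h₂, smul_zero]

variable {V}

theorem mem_invariants {v : V} : v ∈ invariants V ↔ ux₁ • v = 0 ∧ ux₂ • v = 0 :=
  Iff.rfl

theorem isEvenStable_lieSubmodule (S : LieSubmodule ℂ G0 V) : IsEvenStable S.toSubmodule :=
  isEvenStable_iff.2 fun _ _ hs => S.lie_mem hs

/-- Let `S` be the submodule `kacSpan` of the invariants. Since `x₁ x₂ V` is invariant, it lies in
`S`. By `casimir_smul_eq`, `C` sends `x₁ V` and `x₂ V` into `S`, because the remaining terms contain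
both `x₁` and `x₂`. Applying `C` to the same formula for `C v` then gives `C² V ⊆ S`, and `C²` is
surjective. -/
theorem kacSpan_invariants (h : Function.Surjective (actEnd V casimir)) (v : V) :
    v ∈ kacSpan (invariants V).toSubmodule := by
  let S := toSubmodule (kacSpan (invariants V).toSubmodule)
    (isEvenStable_kacSpan (isEvenStable_lieSubmodule _))
    (isOddStable_kacSpan (isEvenStable_lieSubmodule _) fun m hm => hm)
  have hx (v : V) : ux₁ • ux₂ • v ∈ S :=
    mem_kacSpan.2 ⟨ux₁ • ux₂ • v, mem_invariants.2 (by simp only [x_smul_x, smul_zero, neg_zero,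
      and_self]), 0, zero_mem _, 0, zero_mem _, 0, zero_mem _, by simp⟩
  have h₁ (v : V) : casimir • ux₁ • v ∈ S := by
    rw [casimir_smul_eq]
    simp only [x_smul_x, smul_zero, smul_neg, add_zero, sub_zero, sub_neg_eq_add]
    exact S.add_mem (hx _) (S.smul_mem _ (S.smul_mem _ (S.smul_mem _ (hx v))))
  have h₂ (v : V) : casimir • ux₂ • v ∈ S := by
    rw [casimir_smul_eq]
    simp only [x_smul_x, smul_zero, sub_zero]
    exact S.add_mem (hx _) (S.sub_mem (S.smul_mem _ (S.add_mem (S.smul_mem _ (hx v)) (hx v)))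
      (S.smul_mem _ (S.smul_mem _ (hx v))))
  obtain ⟨v, rfl⟩ := h v
  obtain ⟨v, rfl⟩ := h v
  change casimir • casimir • v ∈ S
  rw [casimir_smul_eq v]
  simp only [smul_add, smul_sub, casimir_smul_basis]
  have h₁ : ux₁ • casimir • v ∈ S := by
    rw [← casimir_smul_basis.2.2.2.2.1]
    exact h₁ v
  have h₂ : ux₂ • casimir • v ∈ S := by
    rw [← casimir_smul_basis.2.2.2.2.2.1]
    exact h₂ v
  exact S.sub_mem (S.add_mem (hx _) (S.sub_mem (S.add_mem (S.smul_mem _ (S.smul_mem _ h₁))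
    (S.smul_mem _ h₁)) (S.smul_mem _ (S.smul_mem _ h₁))))
    (S.smul_mem _ (S.smul_mem _ (S.smul_mem _ h₂)))

/-- `x₂ y m` is the image of `m` under an element of `G₀`, hence again invariant and killed by `x₁`.
-/
theorem x_smul_x_smul_y_smul {m : V} (hm : m ∈ invariants V) :
    ux₁ • ux₂ • uy₁ • m = 0 ∧ ux₁ • ux₂ • uy₂ • m = 0 := by
  have h₁ : ux₁ • m = 0 := hm.1
  have h₂ : ux₂ • m = 0 := hm.2
  have hs := isEvenStable_lieSubmodule _ m hm
  have hF : ux₁ • uF • m = 0 := hs.2.2.2.1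
  have hR : ux₁ • uR • m = 0 := hs.2.1.1
  simp only [x_smul_y, h₂, hF, hR, smul_zero, sub_zero, and_self]

/-- On invariants `x₁ x₂` kills everything except the `y₂ y₁` term, which it turns into `C m₃`. Once
`m₃ = 0`, multiplying first by `y₁` or `y₂` promotes the `m₂` or `m₁` term to that place. -/
theorem eq_zero_of_sum_eq_zero (h : Function.Injective (actEnd V casimir)) {m₀ m₁ m₂ m₃ : V}
    (h₀ : m₀ ∈ invariants V) (h₁ : m₁ ∈ invariants V) (h₂ : m₂ ∈ invariants V)
    (h₃ : m₃ ∈ invariants V) (hs : m₀ + uy₁ • m₁ + uy₂ • m₂ + uy₂ • uy₁ • m₃ = 0) :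
    m₀ = 0 ∧ m₁ = 0 ∧ m₂ = 0 ∧ m₃ = 0 := by
  have key {m : V} (hm : m ∈ invariants V) (hm' : ux₁ • ux₂ • uy₂ • uy₁ • m = 0) : m = 0 := by
    rw [x_smul_y_smul_eq_casimir_smul hm.1 hm.2] at hm'
    exact (injective_iff_map_eq_zero _).1 h _ hm'
  have e₀ : ux₂ • m₀ = 0 := h₀.2
  have e₃ : m₃ = 0 := by
    refine key h₃ ?_
    have := congrArg (fun v => ux₁ • ux₂ • v) hs
    simpa only [smul_add, x_smul_x_smul_y_smul h₁, x_smul_x_smul_y_smul h₂, e₀, smul_zero,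
      zero_add] using this
  rw [e₃, smul_zero, smul_zero, add_zero] at hs
  have e₂ : m₂ = 0 := by
    refine key h₂ ?_
    have := congrArg (fun v => ux₁ • ux₂ • uy₁ • v) hs
    simpa only [smul_add, y_smul_y, x_smul_x_smul_y_smul h₀, smul_zero, zero_add, smul_neg,
      neg_eq_zero] using this
  have e₁ : m₁ = 0 := by
    refine key h₁ ?_
    have := congrArg (fun v => ux₁ • ux₂ • uy₂ • v) hs
    simpa only [smul_add, y_smul_y, x_smul_x_smul_y_smul h₀, smul_zero, zero_add, add_zero]
      using this
  rw [e₁, e₂, smul_zero, smul_zero, add_zero, add_zero] at hs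
  exact ⟨hs, e₁, e₂, e₃⟩

/-- When the Casimir element acts bijectively, the module is induced from its invariants. -/
theorem exists_equiv_induced_invariants (h : Function.Bijective (actEnd V casimir)) :
    ∃ e : Induced (invariants V) ≃ₗ[U] V, ∀ w, e (Induced.of (invariants V) w) = (w : V) := by
  obtain ⟨F, hF⟩ := Induced.exists_lift (W := invariants V) (invariants V).toSubmodule.subtype
    (fun _ _ => rfl) (fun w => w.2)
  have hF (w : invariants V) : F (Induced.of (invariants V) w) = (w : V) := hF w
  have hinj : Function.Injective F := by
    refine (injective_iff_map_eq_zero _).2 fun v hv => ?_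
    obtain ⟨w₀, w₁, w₂, w₃, rfl⟩ := Induced.eq_sum v
    simp only [map_add, F.map_smul, hF] at hv
    obtain ⟨h₀, h₁, h₂, h₃⟩ := eq_zero_of_sum_eq_zero h.1 w₀.2 w₁.2 w₂.2 w₃.2 hv
    rw [Subtype.ext (a1 := w₀) (a2 := 0) h₀, Subtype.ext (a1 := w₁) (a2 := 0) h₁,
      Subtype.ext (a1 := w₂) (a2 := 0) h₂, Subtype.ext (a1 := w₃) (a2 := 0) h₃]
    simp
  have hsurj : Function.Surjective F := by
    intro v
    obtain ⟨m₀, h₀, m₁, h₁, m₂, h₂, m₃, h₃, rfl⟩ := mem_kacSpan.1 (kacSpan_invariants h.2 v)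
    refine ⟨Induced.of _ (⟨m₀, h₀⟩ : invariants V) + uy₁ • Induced.of _ (⟨m₁, h₁⟩ : invariants V) +
      uy₂ • Induced.of _ (⟨m₂, h₂⟩ : invariants V) +
      uy₂ • uy₁ • Induced.of _ (⟨m₃, h₃⟩ : invariants V), ?_⟩
    simp only [map_add, F.map_smul, hF]
  exact ⟨LinearEquiv.ofBijective F ⟨hinj, hsurj⟩, hF⟩

/-- `kacSpan` carries complementary `G₀`-submodules of the invariants to complementary
`G`-submodules of `V`, and a nonzero one to a nonzero one. -/
theorem isIndecomposableG0_invariants (h : Function.Bijective (actEnd V casimir))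
    (hV : IsIndecomposable V) : IsIndecomposableG0 (invariants V) := by
  constructor
  · have := hV.1
    obtain ⟨v, hv⟩ := exists_ne (0 : V)
    by_contra hn
    rw [not_nontrivial_iff_subsingleton] at hn
    have hz {m : V} (hm : m ∈ invariants V) : m = 0 :=
      congrArg Subtype.val (Subsingleton.elim (⟨m, hm⟩ : invariants V) 0)
    obtain ⟨m₀, h₀, m₁, h₁, m₂, h₂, m₃, h₃, rfl⟩ := mem_kacSpan.1 (kacSpan_invariants h.2 v)
    rw [hz h₀, hz h₁, hz h₂, hz h₃] at hv
    simp at hv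
  intro A B hAB
  let S (A : LieSubmodule ℂ G0 (invariants V)) : Submodule ℂ V :=
    A.toSubmodule.map (invariants V).toSubmodule.subtype
  have hS (A : LieSubmodule ℂ G0 (invariants V)) {v : V} (hv : v ∈ S A) :
      ∃ hv : v ∈ invariants V, (⟨v, hv⟩ : invariants V) ∈ A := by
    obtain ⟨w, hw, rfl⟩ := hv
    exact ⟨w.2, hw⟩
  have hS₀ (A : LieSubmodule ℂ G0 (invariants V)) : IsEvenStable (S A) := by
    rw [isEvenStable_iff]
    rintro g _ ⟨w, hw, rfl⟩
    have h : ⁅g, (show invariants V from w)⁆ ∈ A := A.lie_mem hw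
    exact ⟨_, h, rfl⟩
  have hS₁ (A : LieSubmodule ℂ G0 (invariants V)) (m) (hm : m ∈ S A) :
      ux₁ • m = 0 ∧ ux₂ • m = 0 :=
    (hS A hm).1
  have hst (A : LieSubmodule ℂ G0 (invariants V)) (g) (a) (ha : a ∈ kacSpan (S A)) :
      ι g • a ∈ kacSpan (S A) :=
    ι_smul_mem (isEvenStable_kacSpan (hS₀ A)) (isOddStable_kacSpan (hS₀ A) (hS₁ A)) g ha
  have hbot (A : LieSubmodule ℂ G0 (invariants V)) (hA : kacSpan (S A) = ⊥) : A = ⊥ := by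
    refine (LieSubmodule.eq_bot_iff _).2 fun w hw => ?_
    refine Subtype.ext ((Submodule.eq_bot_iff _).1 hA w ?_)
    exact mem_kacSpan.2 ⟨_, ⟨w, hw, rfl⟩, 0, zero_mem _, 0, zero_mem _, 0, zero_mem _, by simp⟩
  have hAB' := LieSubmodule.isCompl_toSubmodule.2 hAB
  refine (hV.eq_bot_or_eq_bot _ _ (hst A) (hst B) ⟨?_, ?_⟩).imp (hbot A) (hbot B)
  · refine Submodule.disjoint_def.2 fun x hA hB => ?_
    obtain ⟨a₀, ha₀, a₁, ha₁, a₂, ha₂, a₃, ha₃, ha⟩ := mem_kacSpan.1 hA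
    obtain ⟨b₀, hb₀, b₁, hb₁, b₂, hb₂, b₃, hb₃, hb⟩ := mem_kacSpan.1 hB
    have hsub {a b : V} (ha : a ∈ S A) (hb : b ∈ S B) : a - b ∈ invariants V :=
      (invariants V).sub_mem (hS A ha).1 (hS B hb).1
    have hz {a b : V} (ha : a ∈ S A) (hb : b ∈ S B) (h : a - b = 0) : a = 0 := by
      obtain ⟨ha', ha⟩ := hS A ha
      obtain ⟨hb', hb⟩ := hS B hb
      obtain rfl := sub_eq_zero.1 h
      exact congrArg Subtype.val (Submodule.disjoint_def.1 hAB'.disjoint ⟨a, ha'⟩ ha hb)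
    have hs : (a₀ - b₀) + uy₁ • (a₁ - b₁) + uy₂ • (a₂ - b₂) + uy₂ • uy₁ • (a₃ - b₃) = 0 := by
      rw [← sub_self x]
      nth_rw 1 [ha]
      rw [hb]
      simp only [smul_sub]
      abel
    obtain ⟨h₀, h₁, h₂, h₃⟩ := eq_zero_of_sum_eq_zero h.1 (hsub ha₀ hb₀) (hsub ha₁ hb₁)
      (hsub ha₂ hb₂) (hsub ha₃ hb₃) hs
    rw [ha, hz ha₀ hb₀ h₀, hz ha₁ hb₁ h₁, hz ha₂ hb₂ h₂, hz ha₃ hb₃ h₃]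
    simp
  · rw [codisjoint_iff, eq_top_iff]
    intro v _
    have hm {m : V} (hm : m ∈ (invariants V).toSubmodule) : m ∈ S A ⊔ S B := by
      obtain ⟨a, b, ha, hb, hab⟩ :=
        Submodule.codisjoint_iff_exists_add_eq.1 hAB'.codisjoint ⟨m, hm⟩
      exact Submodule.mem_sup.2 ⟨a, ⟨a, ha, rfl⟩, b, ⟨b, hb, rfl⟩, congrArg Subtype.val hab⟩
    obtain ⟨m₀, h₀, m₁, h₁, m₂, h₂, m₃, h₃, rfl⟩ := mem_kacSpan.1 (kacSpan_invariants h.2 v)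
    obtain ⟨a₀, ha₀, b₀, hb₀, rfl⟩ := Submodule.mem_sup.1 (hm h₀)
    obtain ⟨a₁, ha₁, b₁, hb₁, rfl⟩ := Submodule.mem_sup.1 (hm h₁)
    obtain ⟨a₂, ha₂, b₂, hb₂, rfl⟩ := Submodule.mem_sup.1 (hm h₂)
    obtain ⟨a₃, ha₃, b₃, hb₃, rfl⟩ := Submodule.mem_sup.1 (hm h₃)
    refine Submodule.mem_sup.2 ⟨_, mem_kacSpan.2 ⟨a₀, ha₀, a₁, ha₁, a₂, ha₂, a₃, ha₃, rfl⟩, _,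
      mem_kacSpan.2 ⟨b₀, hb₀, b₁, hb₁, b₂, hb₂, b₃, hb₃, rfl⟩, ?_⟩
    simp only [smul_add]
    abel

end Invariants

/-! ### The grading by the central element of `G₀`. -/

section Grading

variable {V : Type*} [AddCommGroup V] [Module ℂ V]

/-- `Y` raises generalized eigenvalues of `T` by `b`. -/
theorem pow_sub_smul_apply {T Y : Module.End ℂ V} {b : ℂ} (h : ∀ v, T (Y v) = Y (T v) + b • Y v)
    (a : ℂ) (k : ℕ) (v : V) :
    ((T - a • 1) ^ k) (Y v) = Y (((T - (a - b) • 1) ^ k) v) := by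
  induction k generalizing v with
  | zero => rfl
  | succ k ih =>
    have h' : (T - a • 1) (Y v) = Y ((T - (a - b) • 1) v) := by
      simp only [LinearMap.sub_apply, LinearMap.smul_apply, Module.End.one_apply, h, map_sub,
        map_smul]
      module
    rw [pow_succ, pow_succ, Module.End.mul_apply, Module.End.mul_apply, h', ih]

theorem eq_zero_of_mem_maxGenEigenspace {T : Module.End ℂ V} {a b : ℂ} (hab : a ≠ b) {v : V}
    (ha : v ∈ T.maxGenEigenspace a) (hb : v ∈ T.maxGenEigenspace b) : v = 0 :=
  Submodule.disjoint_def.1 (Module.End.disjoint_genEigenspace T hab ⊤ ⊤) v ha hb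

variable [Module U V]

/-- The central element `P + R` of `G₀` defines the grading of `G`. -/
theorem center_smul :
    (∀ v : V, (uP + uR) • uP • v = uP • (uP + uR) • v) ∧
    (∀ v : V, (uP + uR) • uR • v = uR • (uP + uR) • v) ∧
    (∀ v : V, (uP + uR) • uE • v = uE • (uP + uR) • v) ∧
    (∀ v : V, (uP + uR) • uF • v = uF • (uP + uR) • v) ∧
    (∀ v : V, (uP + uR) • ux₁ • v = ux₁ • (uP + uR) • v + (-1 : ℂ) • ux₁ • v) ∧
    (∀ v : V, (uP + uR) • ux₂ • v = ux₂ • (uP + uR) • v + (-1 : ℂ) • ux₂ • v) ∧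
    (∀ v : V, (uP + uR) • uy₁ • v = uy₁ • (uP + uR) • v + (1 : ℂ) • uy₁ • v) ∧
    (∀ v : V, (uP + uR) • uy₂ • v = uy₂ • (uP + uR) • v + (1 : ℂ) • uy₂ • v) := by
  refine ⟨fun v => ?_, fun v => ?_, fun v => ?_, fun v => ?_, fun v => ?_, fun v => ?_,
    fun v => ?_, fun v => ?_⟩ <;>
    simp only [add_smul, smul_add, even_smul_even, even_smul_x, even_smul_y, neg_smul, one_smul] <;>
    abel

variable [IsScalarTower ℂ U V]

theorem ι_H_smul (h : H) (v : V) : ι h.1 • v = h.1.1 0 0 • uP • v + h.1.1 1 1 • uR • v := by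
  have e (i j : Fin 3) (hij : i ≠ j) : h.1.1 i j = 0 := h.2 i j hij
  rw [ι_smul, e 0 1 (by decide), e 1 0 (by decide), e 0 2 (by decide), e 1 2 (by decide),
    e 2 0 (by decide), e 2 1 (by decide)]
  simp only [zero_smul, add_zero]

/-- `P + R` commutes with `G₀` and inherits local finiteness from `V`, so indecomposability of `S`
leaves one generalized eigenvalue. -/
theorem IsWeightModule.exists_center_eigenvalue (hV : IsWeightModule V)
    {S : LieSubmodule ℂ G0 V} (hS : IsIndecomposableG0 S) :
    ∃ c, S.toSubmodule ≤ (actEnd V (uP + uR)).maxGenEigenspace c := by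
  have hlf : IsLocallyFinite (actEnd V (uP + uR)) := hV.isLocallyFinite fun h v => by
    simp only [ι_H_smul, map_add, map_smul]
    simp only [actEnd_apply, center_smul]
  let T' : Module.End ℂ S := LieModule.toEnd ℂ G0 S (even 1 0 0 1)
  have hT' (s : S) : (T' s : V) = actEnd V (uP + uR) s := by
    change ι (G0.toG (even 1 0 0 1)) • (s : V) = (uP + uR) • (s : V)
    rw [ι_even]
    simp
  obtain ⟨c, hc⟩ := hS.exists_maxGenEigenspace_eq_top (hlf.restrict hT') fun g s => by
    refine Subtype.ext ?_
    rw [hT']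
    change _ = ι (G0.toG g) • (T' s : V)
    rw [hT']
    exact ι_smul_commute ⟨center_smul.1, center_smul.2.1, center_smul.2.2.1, center_smul.2.2.2.1⟩
      g (s : V)
  refine ⟨c, fun s hs => ?_⟩
  have hs' : (⟨s, hs⟩ : S) ∈ T'.maxGenEigenspace c := by
    rw [hc]
    trivial
  obtain ⟨k, hk⟩ := (Module.End.mem_maxGenEigenspace ..).1 hs'
  refine (Module.End.mem_maxGenEigenspace ..).2 ⟨k, ?_⟩
  have key : ∀ (k : ℕ) (w : S),
      (((T' - c • 1) ^ k) w : V) = ((actEnd V (uP + uR) - c • 1) ^ k) (w : V) := by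
    intro k
    induction k with
    | zero => simp
    | succ k ih =>
      intro w
      rw [pow_succ, pow_succ, Module.End.mul_apply, Module.End.mul_apply, ih]
      congr 1
      exact congrArg (· - c • (w : V)) (hT' w)
  exact (key k ⟨s, hs⟩).symm.trans (congrArg Subtype.val hk)

/-- The common nonzero vector `v` forces `P + R` to have the same generalized eigenvalue `c` on `S`
and on the invariants. For `s` in `S`, applying `(P + R - c)ᵏ` to its decomposition shows that `m₁`,
`m₂` have generalized eigenvalue `c - 1` and `m₃` has `c - 2`; as invariants they also have `c`, so
they vanish. -/
theorem le_invariants (hweight : IsWeightModule V) (h : Function.Bijective (actEnd V casimir))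
    (hV : IsIndecomposable V) {S : LieSubmodule ℂ G0 V} (hS : IsIndecomposableG0 S)
    {v : V} (hv : v ≠ 0) (hvS : v ∈ S) (hv' : v ∈ invariants V) : S ≤ invariants V := by
  obtain ⟨c, hc⟩ := hweight.exists_center_eigenvalue (isIndecomposableG0_invariants h hV)
  obtain ⟨c', hc'⟩ := hweight.exists_center_eigenvalue hS
  obtain rfl : c = c' := by
    by_contra hne
    exact hv (eq_zero_of_mem_maxGenEigenspace hne (hc hv') (hc' hvS))
  intro s hs
  obtain ⟨k, hk⟩ := (Module.End.mem_maxGenEigenspace ..).1 (hc' hs)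
  obtain ⟨m₀, h₀, m₁, h₁, m₂, h₂, m₃, h₃, rfl⟩ := mem_kacSpan.1 (kacSpan_invariants h.2 s)
  have comm := center_smul (V := V)
  have ey₁ := pow_sub_smul_apply (T := actEnd V (uP + uR)) (Y := actEnd V uy₁) comm.2.2.2.2.2.2.1
  have ey₂ := pow_sub_smul_apply (T := actEnd V (uP + uR)) (Y := actEnd V uy₂) comm.2.2.2.2.2.2.2
  have ex₁ := pow_sub_smul_apply (T := actEnd V (uP + uR)) (Y := actEnd V ux₁) comm.2.2.2.2.1
  have ex₂ := pow_sub_smul_apply (T := actEnd V (uP + uR)) (Y := actEnd V ux₂) comm.2.2.2.2.2.1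
  simp only [actEnd_apply] at ey₁ ey₂ ex₁ ex₂
  have hinv (a : ℂ) {m : V} (hm : m ∈ invariants V) :
      ((actEnd V (uP + uR) - a • 1) ^ k) m ∈ invariants V := by
    have h₁ : ux₁ • m = 0 := hm.1
    have h₂ : ux₂ • m = 0 := hm.2
    -- `x₁` and `x₂` lower the eigenvalue by one, so the parameter `a - 1` on the left gives `a` on
    -- the right.
    have e₁ := ex₁ (a - 1) k m
    have e₂ := ex₂ (a - 1) k m
    rw [h₁, map_zero, sub_neg_eq_add, sub_add_cancel] at e₁
    rw [h₂, map_zero, sub_neg_eq_add, sub_add_cancel] at e₂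
    exact ⟨e₁.symm, e₂.symm⟩
  simp only [map_add, ey₁, ey₂] at hk
  obtain ⟨-, z₁, z₂, z₃⟩ :=
    eq_zero_of_sum_eq_zero h.1 (hinv _ h₀) (hinv _ h₁) (hinv _ h₂) (hinv _ h₃) hk
  have hz {a : ℂ} {m : V} (ha : c ≠ a) (hm : m ∈ invariants V)
      (h : ((actEnd V (uP + uR) - a • 1) ^ k) m = 0) : m = 0 :=
    eq_zero_of_mem_maxGenEigenspace ha (hc hm) ((Module.End.mem_maxGenEigenspace ..).2 ⟨k, h⟩)
  have hne : c ≠ c - 1 := by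
    intro h
    have : (1 : ℂ) = 0 := by linear_combination h
    exact one_ne_zero this
  have hne' : c ≠ c - 1 - 1 := by
    intro h
    have : (2 : ℂ) = 0 := by linear_combination h
    exact two_ne_zero this
  rw [hz hne h₁ z₁, hz hne h₂ z₂, hz hne' h₃ z₃]
  simpa using h₀

end Grading

end SL21

end

/-! ### The proposition. -/

theorem proposition3p3
    {V : Type*} [AddCommGroup V] [Module ℂ V] [Module SL21.U V] [IsScalarTower ℂ SL21.U V]
    (hweight : SL21.IsWeightModule V) (hV : SL21.IsIndecomposable V)
    {W : Type*} [AddCommGroup W] [Module ℂ W] [LieRingModule SL21.G0 W] [LieModule ℂ SL21.G0 W]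
    (hW : SL21.IsIndecomposableG0 W) (htyp : SL21.IsTypical W)
    (φ : SL21.Induced W →ₗ[SL21.U] V) (hφ : Function.Injective φ) :
    (∃ W' : LieSubmodule ℂ SL21.G0 V,
      Maximal (fun S : LieSubmodule ℂ SL21.G0 V =>
        SL21.IsIndecomposableG0 S ∧ ∀ w : W, φ (SL21.Induced.of W w) ∈ S) W') ∧
    ∀ W' : LieSubmodule ℂ SL21.G0 V,
      Maximal (fun S : LieSubmodule ℂ SL21.G0 V =>
        SL21.IsIndecomposableG0 S ∧ ∀ w : W, φ (SL21.Induced.of W w) ∈ S) W' →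
      ∃ e : SL21.Induced W' ≃ₗ[SL21.U] V, ∀ w : W', e (SL21.Induced.of W' w) = (w : V) := by
  have := hW.1
  have hC := htyp.casimir_bijective hweight hV φ hφ
  have hM := SL21.isIndecomposableG0_invariants hC hV
  have hWM (w : W) : φ (SL21.Induced.of W w) ∈ SL21.invariants V := by
    refine SL21.mem_invariants.2 ?_
    rw [← φ.map_smul, ← φ.map_smul, (SL21.Induced.x_smul_of w).1, (SL21.Induced.x_smul_of w).2,
      map_zero]
    exact ⟨rfl, rfl⟩
  obtain ⟨w, hw⟩ := exists_ne (0 : W)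
  have hw' : φ (SL21.Induced.of W w) ≠ 0 := by
    rw [Ne, map_eq_zero_iff φ hφ, map_eq_zero_iff _ SL21.Induced.of_injective]
    exact hw
  have hle (S : LieSubmodule ℂ SL21.G0 V) (hS : SL21.IsIndecomposableG0 S)
      (hWS : ∀ w : W, φ (SL21.Induced.of W w) ∈ S) : S ≤ SL21.invariants V :=
    SL21.le_invariants hweight hC hV hS hw' (hWS w) (hWM w)
  -- The invariants are the largest candidate, so they are maximal and every maximal candidate
  -- equals them.
  refine ⟨⟨SL21.invariants V, ⟨hM, hWM⟩, fun S hS _ => hle S hS.1 hS.2⟩, fun W' hW' => ?_⟩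
  have hle' := hle W' hW'.1.1 hW'.1.2
  obtain rfl : W' = SL21.invariants V := le_antisymm hle' (hW'.2 ⟨hM, hWM⟩ hle')
  exact SL21.exists_equiv_induced_invariants hC
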